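/- Let $T\ge 3$ and consider paths $\omega=(s_1,\dots,s_T)\in\{1,2\}^T$ under the toric homogeneous Markov chain model without initial parameters, $p(\omega)=c\,\beta_{s_1s_2}\beta_{s_2s_3}\cdots\beta_{s_{T-1}s_T}$. Let $A$ be its configuration: the integer matrix with rows indexed by the transitions $(i,j)\in\{1,2\}^2$ and columns indexed by the paths, whose entry at $((i,j),\omega)$ is the number of $t<T$ with $s_t=i$, $s_{t+1}=j$. For an integer vector $b$, the fiber $\mathcal F_b$ is the set of all $x\in\mathbb Z_{\ge0}^{\{1,2\}^T}$ with $Ax=b$. A move is an integer array $z$ with $Az=0$. A Markov basis is a finite set $\mathcal Z$ of moves such that for all $b$ and all $x,y\in\mathcal F_b$ there are $z_1,\dots,z_K\in\mathcal Z$ with $y=x+\sum_{k=1}^K z_k$ and $x+\sum_{k=1}^l z_k\ge0$ for $l=1,\dots,K$. A swapping $P\leftrightarrow Q$ of two multisets of paths gives the two arrays $\pm z$, where $z(\omega)$ is the multiplicity of $\omega$ in $P$ minus its multiplicity in $Q$. The degree of an array $z$ is $\sum_\omega\max(z(\omega),0)$. Write $s_{t:t'}=s_t\dots s_{t'}$ (empty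 if $t>t'$) and $i^k$ for $k$ consecutive entries $i$. Below, $i\ne j$ always denote the two states, in either order. **Theorem 3.1.** For every $T\ge3$, the arrays given by the following swappings form a Markov basis of this model, and all of them have degree at most three. 1. *Type I degree one moves.* If $s_{t_0}=s_{t_1}=s_{t_2}=i$ with $1\le t_0<t_1<t_2\le T$ and $s_t=j$ for some $t_0<t<t_2$: $$(s_{1:t_0-1},s_{t_0:t_2},s_{t_2+1:T})\leftrightarrow(s_{1:t_0-1},s_{t_1:t_2-1},s_{t_0:t_1},s_{t_2+1:T}).$$ 2. *Crossing path swappings.* If $\omega=(s_1,\dots,s_T)$ and $\omega'=(s'_1,\dots,s'_T)$ satisfy $s_t=s'_t$ for some $1\le t\le T$: $$\{\omega,\omega'\}\leftrightarrow\{(s_{1:t},s'_{t+1:T}),(s'_{1:t},s_{t+1:T})\}.$$ 3. *2 by 2 swaps.* Let $t_0\neq t_1$ be in $\{1,\dots,T-1\}$, let $\omega$ have the transition $ii$ and $\omega'$ the transition $jj$ at time $t_0$ (that is, from $t_0$ to $t_0+1$), and let one of $\omega,\omega'$ have the transition $ij$ and the other one $ji$ at time $t_1$. Then $\{\omega,\omega'\}\leftrightarrow\{\tilde\omega,\tilde\omega'\}$,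 where $\tilde\omega,\tilde\omega'$ are obtained from $\omega,\omega'$ by exchanging the parts of the two paths after time $t_0$, and then exchanging the parts after time $t_1$ of the two resulting paths. 4. *Moves of type (iv), only if $T\ge4$.* For $t_0,t_1\in\{1,\dots,T-2\}$: $$\{(s_{1:t_0-1},i,i,j,s_{t_0+3:T}),(s'_{1:t_1-1},i,j,j,s'_{t_1+3:T})\}\leftrightarrow\{(s_{1:t_0-1},i,j,j,s_{t_0+3:T}),(s'_{1:t_1-1},i,i,j,s'_{t_1+3:T})\}.$$ 5. *Type II degree one moves.* If $s_1=s_T=i$ and $s_t=j$ with $1<t<T$: $$(s_1,\dots,s_T)\leftrightarrow(s_t,\dots,s_{T-1},s_1,\dots,s_t).$$ 6. *Degree 3 sliding moves.* For integers $1\le a\le b$ with $a+b\le T-1$ and $b\le u\le T-1-a$, put $a'=a+u$, $b'=b+T-1-u$: $$\{1^T,\ 1^a2^{T-a},\ 1^b2^{T-b}\}\leftrightarrow\{2^T,\ 1^{a'}2^{T-a'},\ 1^{b'}2^{T-b'}\}$$ (as multisets), together with the time reversals of these swappings, in which every path is read backwards. -/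

import Mathlib

/-- Paths `ω = (s₁, …, s_T)` of length `T` over the state space `S`. -/
abbrev StatePath (S : Type) (T : ℕ) : Type := List.Vector S T

/-- Integer arrays `{z(ω)}` indexed by the paths of length `T`; contingency tables are the
nonnegative ones. -/
abbrev PathArray (S : Type) (T : ℕ) : Type := StatePath S T → ℤ

/-- The number of `t` with `s_t = i` and `s_{t+1} = j` in the sequence `l = (s₁, …, s_T)`. -/
def numTransitions {S : Type} [DecidableEq S] (i j : S) (l : List S) : ℕ :=
  (l.zip l.tail).count (i, j)

/-- The configuration `A` of the model `p(ω) = c β_{s₁ s₂} ⋯ β_{s_{T-1} s_T}`.  The column of `ω`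
is the exponent vector of the monomial `β_{s₁ s₂} ⋯ β_{s_{T-1} s_T}`. -/
def config (S : Type) [DecidableEq S] (T : ℕ) : Matrix (S × S) (StatePath S T) ℤ :=
  Matrix.of fun ij ω => (numTransitions ij.1 ij.2 ω.toList : ℤ)

/-- The fiber of `b`: all contingency tables `x ≥ 0` with sufficient statistic `A x = b`. -/
def fiber {S : Type} [DecidableEq S] [Fintype S] (T : ℕ) (b : S × S → ℤ) :
    Set (PathArray S T) :=
  {x | 0 ≤ x ∧ (config S T).mulVec x = b}

/-- A Markov basis of the model without initial parameters: a finite set `Z` of moves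
(`A z = 0`) such that any two tables of any fiber are joined by a sequence of moves of `Z` whose
partial sums all stay nonnegative. -/
def IsMarkovBasis {S : Type} [DecidableEq S] [Fintype S] {T : ℕ}
    (Z : Set (PathArray S T)) : Prop :=
  Z.Finite ∧ (∀ z ∈ Z, (config S T).mulVec z = 0) ∧
    ∀ b : S × S → ℤ, ∀ x ∈ fiber T b, ∀ y ∈ fiber T b,
      ∃ (K : ℕ) (z : ℕ → PathArray S T), (∀ k < K, z k ∈ Z) ∧
        y = x + ∑ k ∈ Finset.range K, z k ∧
        ∀ l ≤ K, 0 ≤ x + ∑ k ∈ Finset.range l, z k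

/-- The degree of a move `z`: the sum of the positive entries of `z`. -/
def moveDegree {S : Type} [Fintype S] {T : ℕ} (z : PathArray S T) : ℤ :=
  ∑ ω, max (z ω) 0

/-- The contingency table of a multiset of paths. -/
def tableOf {S : Type} [DecidableEq S] {T : ℕ} (P : Multiset (StatePath S T)) : PathArray S T :=
  fun ω => (P.count ω : ℤ)

/-- The arrays obtained from a family `R` of swappings `P ↔ Q` of multisets of sequences, in both
directions: all differences `P - Q` and `Q - P` where `P`, `Q` consist of paths of length `T`. -/
def swapMoves {S : Type} [DecidableEq S] (T : ℕ)
    (R : Multiset (List S) → Multiset (List S) → Prop) : Set (PathArray S T) :=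
  {z | ∃ P Q : Multiset (StatePath S T),
    (R (P.map List.Vector.toList) (Q.map List.Vector.toList) ∨
      R (Q.map List.Vector.toList) (P.map List.Vector.toList)) ∧
    z = tableOf P - tableOf Q}

/-- Type I degree one swappings.  In
`(s_{1:t₀-1}, s_{t₀:t₁-1}, s_{t₁:t₂-1}, s_{t₂:T})` with `s_{t₀} = s_{t₁} = s_{t₂} = i` and some
state `≠ i` between `t₀` and `t₂`, the two middle blocks are exchanged.  Here `p = s_{1:t₀-1}`,
`i :: a = s_{t₀:t₁-1}`, `i :: b = s_{t₁:t₂-1}` and `i :: q = s_{t₂:T}`. -/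
def TypeOneSwap {S : Type} (P Q : Multiset (List S)) : Prop :=
  ∃ (i : S) (p a b q : List S), (∃ j ∈ a ++ b, j ≠ i) ∧
    P = {p ++ i :: a ++ i :: b ++ i :: q} ∧
    Q = {p ++ i :: b ++ i :: a ++ i :: q}

/-- Crossing path swappings: two paths that meet at a node `(i, t)` (with `t - 1` the common length
of `p` and `p'`) exchange their parts after time `t`. -/
def CrossingSwap {S : Type} (P Q : Multiset (List S)) : Prop :=
  ∃ (i : S) (p q p' q' : List S), p.length = p'.length ∧
    P = {p ++ i :: q, p' ++ i :: q'} ∧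
    Q = {p ++ i :: q', p' ++ i :: q}

/-- The sequence `l = (s₁, …, s_T)` has `s_t = i` and `s_{t+1} = j`, for a time `t ≥ 1`.
(List positions are counted from zero.) -/
def HasEdge {S : Type} (l : List S) (t : ℕ) (i j : S) : Prop :=
  1 ≤ t ∧ l[t - 1]? = some i ∧ l[t]? = some j

/-- `(s_{1:t}, s'_{t+1:T})`, for `l = (s₁, …, s_T)` and `l' = (s'₁, …, s'_T)`. -/
def spliceAt {S : Type} (t : ℕ) (l l' : List S) : List S :=
  l.take t ++ l'.drop t

/-- 2 by 2 swaps of two paths `ω`, `ω'`.  At time `t₀` one has transitions `ii` in `ω` and `jj` in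
`ω'`; at another time `t₁` one has `ij` in one of the two paths and `ji` in the other one.
The paths exchange their parts after `t₀` and then their parts after `t₁`, which replaces `ii`, `jj`
by `ij`, `ji` at `t₀` and `ij`, `ji` by `ii`, `jj` at `t₁`. -/
def TwoByTwoSwap {S : Type} (P Q : Multiset (List S)) : Prop :=
  ∃ (i j : S) (t₀ t₁ : ℕ) (ω ω' : List S), i ≠ j ∧ t₀ ≠ t₁ ∧
    HasEdge ω t₀ i i ∧ HasEdge ω' t₀ j j ∧
    (HasEdge ω t₁ i j ∧ HasEdge ω' t₁ j i ∨ HasEdge ω t₁ j i ∧ HasEdge ω' t₁ i j) ∧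
    P = {ω, ω'} ∧
    Q = {spliceAt t₁ (spliceAt t₀ ω ω') (spliceAt t₀ ω' ω),
      spliceAt t₁ (spliceAt t₀ ω' ω) (spliceAt t₀ ω ω')}

/-- Degree two swappings: `iij` at times `t₀, t₀+1, t₀+2` of one path becomes `ijj`
while `ijj` at times `t₁, t₁+1, t₁+2` of another path becomes `iij`. -/
def TypeFourSwap {S : Type} (P Q : Multiset (List S)) : Prop :=
  ∃ (i j : S) (p q p' q' : List S), i ≠ j ∧
    P = {p ++ [i, i, j] ++ q, p' ++ [i, j, j] ++ q'} ∧
    Q = {p ++ [i, j, j] ++ q, p' ++ [i, i, j] ++ q'}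

/-- Type II degree one swappings: a non-flat cycle `(s₁, …, s_T)` with `s₁ = s_T = i` and
`s_t = j ≠ i` becomes `(s_t, …, s_{T-1}, s₁, …, s_t)`.  Here `i :: a = s_{1:t-1}` and
`j :: b = s_{t:T-1}`. -/
def TypeTwoSwap {S : Type} (P Q : Multiset (List S)) : Prop :=
  ∃ (i j : S) (a b : List S), i ≠ j ∧
    P = {i :: a ++ j :: b ++ [i]} ∧
    Q = {j :: b ++ i :: a ++ [j]}

/-- The sequence `i … i j … j` of length `T` with `a` entries `i`: for `1 ≤ a < T` the single-step
path from `i` to `j` at time `a`. -/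
def stepPath {S : Type} (T : ℕ) (i j : S) (a : ℕ) : List S :=
  List.replicate a i ++ List.replicate (T - a) j

/-- Degree three sliding swappings.  The first alternative is `W₁ ↔ W₂` with
`a' = a + u`, `b' = b + (T - 1 - u)`, for single-step paths from `i` to `j`;
the second alternative is its time reversal. -/
def SlidingSwap {S : Type} (T : ℕ) (i j : S) (P Q : Multiset (List S)) : Prop :=
  ∃ a b u : ℕ, 1 ≤ a ∧ a ≤ b ∧ a + b ≤ T - 1 ∧ b ≤ u ∧ u ≤ T - 1 - a ∧
    ∃ W₁ W₂ : Multiset (List S),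
      W₁ = {List.replicate T i, stepPath T i j a, stepPath T i j b} ∧
      W₂ = {List.replicate T j, stepPath T i j (a + u), stepPath T i j (b + (T - 1 - u))} ∧
      (P = W₁ ∧ Q = W₂ ∨ P = W₁.map List.reverse ∧ Q = W₂.map List.reverse)

/-- The moves for the two-state model; the states `1`, `2` are coded as `0`, `1` in `Fin 2`. -/
def twoStateMoves (T : ℕ) : Set (PathArray (Fin 2) T) :=
  swapMoves T TypeOneSwap ∪ swapMoves T CrossingSwap ∪ swapMoves T TwoByTwoSwap ∪
    {z | 4 ≤ T ∧ z ∈ swapMoves T TypeFourSwap} ∪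
    swapMoves T TypeTwoSwap ∪ swapMoves T (SlidingSwap T 0 1)

/-! ### Counting transitions in a sequence. -/

section Transitions

variable {S : Type} [DecidableEq S] (i j : S)

/-! A nonnegative table is a multiset of paths, and its fiber records the total transition counts,
which also determine the number of paths. By induction on that number it is enough to change two
multisets `P`, `Q` with equal totals, by swappings, until they share a path, which is then cancelled
(`linked_of_totalTransitions_eq`).

Up to degree one moves a path is just its transition counts (`linked_of_sameTransitions`): its type,
meaning the numbers of switches 01 and 10, and its number of loops 11; the loops 00 follow from the
length.

Types: crossings lower the sum of the squares of the switch counts until the multiset is balanced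
(`exists_linked_balanced`). Averaging shows that two balanced multisets with equal totals have a
type in common (`exists_switchType_eq`).

Loops: two non-constant paths can trade a loop 00 for a loop 11 without changing their types
(`exists_linked_exchange`). Hence, on both sides, loops 11 are gathered in a path of the common type
until it has no loop 00 or no other path has a loop 11. Its number of loops 11 is then the smaller
of its capacity and the common total, so both sides contain the same path up to degree one moves
(`exists_linked_mem_of_forall_pos`).

Constant paths cannot take part in this trade. If a balanced `P` contains one, all its paths have at
most one switch, and the averages force a constant path in `Q`. When one side has `0^T` and the
other `1^T`, the total of loops 11 is at least `T - 1`; after gathering, a sliding move or a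
crossing produces `1^T` on the first side too (`exists_linked_replicate_one`). -/

@[simp] lemma numTransitions_nil : numTransitions i j [] = 0 := rfl

@[simp] lemma numTransitions_singleton (x : S) : numTransitions i j [x] = 0 := rfl

@[simp] lemma numTransitions_cons_cons (x y : S) (l : List S) :
    numTransitions i j (x :: y :: l) =
      numTransitions i j (y :: l) + if x = i ∧ y = j then 1 else 0 := by
  simp [numTransitions, List.count_cons, Prod.ext_iff]

lemma numTransitions_append_cons (p q : List S) (x : S) :
    numTransitions i j (p ++ x :: q) =
      numTransitions i j (p ++ [x]) + numTransitions i j (x :: q) := by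
  induction p with
  | nil => simp
  | cons y p ih =>
    cases p with
    | nil => simp; omega
    | cons z p => simp only [List.cons_append, numTransitions_cons_cons] at ih ⊢; omega

lemma numTransitions_append_cons_cons (p q : List S) (x y : S) :
    numTransitions i j (p ++ x :: y :: q) =
      numTransitions i j (p ++ [x]) + numTransitions i j (y :: q) +
        if x = i ∧ y = j then 1 else 0 := by
  rw [numTransitions_append_cons, numTransitions_cons_cons]; omega

lemma numTransitions_replicate (x : S) (n : ℕ) :
    numTransitions i j (List.replicate n x) = if x = i ∧ x = j then n - 1 else 0 := by
  induction n with
  | zero => simp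
  | succ n ih =>
    cases n with
    | zero => simp
    | succ n =>
      rw [List.replicate_succ, List.replicate_succ, numTransitions_cons_cons,
        ← List.replicate_succ, ih]
      split_ifs <;> omega

lemma numTransitions_replicate_append (x : S) (n : ℕ) (l : List S) :
    numTransitions i j (List.replicate n x ++ x :: l) =
      numTransitions i j (x :: l) + if x = i ∧ x = j then n else 0 := by
  have h : List.replicate n x ++ [x] = List.replicate (n + 1) x := by
    rw [List.replicate_succ']
  rw [numTransitions_append_cons, h, numTransitions_replicate]
  split_ifs <;> omega

lemma numTransitions_reverse (l : List S) :
    numTransitions i j l.reverse = numTransitions j i l := by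
  induction l with
  | nil => rfl
  | cons x l ih =>
    cases l with
    | nil => rfl
    | cons y l =>
      rw [numTransitions_cons_cons, ← ih, List.reverse_cons, List.reverse_cons,
        List.append_assoc, List.singleton_append, numTransitions_append_cons_cons]
      simp [and_comm]

lemma exists_append_of_numTransitions_pos {l : List S} (h : 0 < numTransitions i j l) :
    ∃ p q, l = p ++ i :: j :: q := by
  induction l with
  | nil => simp at h
  | cons x l ih =>
    cases l with
    | nil => simp at h
    | cons y l =>
      by_cases hxy : x = i ∧ y = j
      · exact ⟨[], l, by simp [hxy]⟩
      · rw [numTransitions_cons_cons, if_neg hxy, add_zero] at h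
        obtain ⟨p, q, hpq⟩ := ih h
        exact ⟨x :: p, q, by rw [hpq]; rfl⟩

/-- Two sequences with the same numbers of transitions of every kind. -/
def SameTransitions (l l' : List S) : Prop :=
  ∀ i j, numTransitions i j l = numTransitions i j l'

end Transitions

/-! ### Two-state paths: alternation of switches, meeting times. -/

/-- The number of changes of state in a two-state path. -/
def numSwitches (l : List (Fin 2)) : ℕ := numTransitions 0 1 l + numTransitions 1 0 l

lemma sum_numTransitions (l : List (Fin 2)) :
    numTransitions 0 0 l + numTransitions 1 1 l + numTransitions 0 1 l + numTransitions 1 0 l =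
      l.length - 1 := by
  induction l with
  | nil => rfl
  | cons x l ih =>
    cases l with
    | nil => rfl
    | cons y l =>
      simp only [numTransitions_cons_cons, List.length_cons] at ih ⊢
      fin_cases x <;> fin_cases y <;> simp at ih ⊢ <;> omega

/-- The switches of a two-state path from `0` to `1` and from `1` to `0` alternate. -/
lemma numTransitions_switch_cons (x : Fin 2) (l : List (Fin 2)) :
    (x = 0 ∧ (numTransitions 0 1 (x :: l) = numTransitions 1 0 (x :: l) ∨
      numTransitions 0 1 (x :: l) = numTransitions 1 0 (x :: l) + 1)) ∨
    (x = 1 ∧ (numTransitions 0 1 (x :: l) = numTransitions 1 0 (x :: l) ∨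
      numTransitions 0 1 (x :: l) + 1 = numTransitions 1 0 (x :: l))) := by
  induction l generalizing x with
  | nil => fin_cases x <;> simp
  | cons y l ih =>
    have := ih y
    simp only [numTransitions_cons_cons] at this ⊢
    fin_cases x <;> fin_cases y <;> simp at this ⊢ <;> omega

lemma numTransitions_switch_le (l : List (Fin 2)) :
    numTransitions 0 1 l ≤ numTransitions 1 0 l + 1 ∧
      numTransitions 1 0 l ≤ numTransitions 0 1 l + 1 := by
  cases l with
  | nil => simp
  | cons x l => rcases numTransitions_switch_cons x l with h | h <;> omega

lemma eq_replicate_of_numSwitches_eq_zero {x : Fin 2} {l : List (Fin 2)}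
    (h : numSwitches (x :: l) = 0) : x :: l = List.replicate (l.length + 1) x := by
  induction l generalizing x with
  | nil => rfl
  | cons y l ih =>
    have hxy : x = y := by
      unfold numSwitches at h
      simp only [numTransitions_cons_cons] at h
      fin_cases x <;> fin_cases y <;> simp at h ⊢
    subst hxy
    have h' : numSwitches (x :: l) = 0 := by
      unfold numSwitches at h ⊢
      simp only [numTransitions_cons_cons] at h
      omega
    rw [ih h']
    simp [List.replicate_succ]

/-- If `v` has at least `d` switches more than `w`, where `d` is even exactly when the two paths
start in the same state, then the paths meet at a time up to which `v` has `d` switches more. -/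
lemma exists_meeting {v w : List (Fin 2)} {x y : Fin 2} {d : ℕ} (hlen : v.length = w.length)
    (hd : x = y ↔ Even d) (h : numSwitches (y :: w) + d ≤ numSwitches (x :: v)) :
    ∃ (i : Fin 2) (p q p' q' : List (Fin 2)), p.length = p'.length ∧ x :: v = p ++ i :: q ∧
      y :: w = p' ++ i :: q' ∧ numSwitches (p ++ [i]) = numSwitches (p' ++ [i]) + d := by
  induction v generalizing w x y d with
  | nil =>
    have hw : w = [] := by simpa using hlen.symm
    subst hw
    have hd0 : d = 0 := by simpa [numSwitches] using h
    subst hd0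
    obtain rfl : x = y := hd.2 (by simp)
    exact ⟨x, [], [], [], [], rfl, rfl, rfl, rfl⟩
  | cons x' v ih =>
    rcases Nat.eq_zero_or_pos d with rfl | hpos
    · obtain rfl : x = y := hd.2 (by simp)
      exact ⟨x, [], _, [], _, rfl, rfl, rfl, rfl⟩
    cases w with
    | nil => simp at hlen
    | cons y' w =>
      have hlen' : v.length = w.length := by simpa using hlen
      -- `d'` is the lead still to be gained after this step. It changes by at most one and stays
      -- even exactly when the two states agree. The inequality makes it zero by the last time at
      -- the latest, and the paths meet when it vanishes: a discrete intermediate value argument.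
      obtain ⟨d', hd', h', hs⟩ : ∃ d', (x' = y' ↔ Even d') ∧
          numSwitches (y' :: w) + d' ≤ numSwitches (x' :: v) ∧
          d' + (if x = x' then 0 else 1) = d + (if y = y' then 0 else 1) := by
        refine ⟨d + (if y = y' then 0 else 1) - (if x = x' then 0 else 1), ?_, ?_, ?_⟩
        · rw [Nat.even_iff] at hd ⊢
          fin_cases x <;> fin_cases x' <;> fin_cases y <;> fin_cases y' <;> simp at hd ⊢ <;> omega
        · unfold numSwitches at h ⊢
          simp only [numTransitions_cons_cons] at h
          fin_cases x <;> fin_cases x' <;> fin_cases y <;> fin_cases y' <;> simp at h ⊢ <;> omega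
        · split_ifs <;> omega
      obtain ⟨i, p, q, p', q', hpp, hv, hw, hsw⟩ := ih hlen' hd' h'
      refine ⟨i, x :: p, q, y :: p', q', by simp [hpp], by simp [hv], by simp [hw], ?_⟩
      have key : ∀ (z z' : Fin 2) (r s : List (Fin 2)), z' :: r = s ++ [i] →
          numSwitches (z :: s ++ [i]) = numSwitches (s ++ [i]) + if z = z' then 0 else 1 := by
        intro z z' r s hr
        rw [List.cons_append, ← hr]
        unfold numSwitches
        simp only [numTransitions_cons_cons]
        fin_cases z <;> fin_cases z' <;> simp <;> omega
      have hhead : ∀ (z' : Fin 2) (u s t : List (Fin 2)), z' :: u = s ++ i :: t →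
          ∃ r, z' :: r = s ++ [i] := by
        intro z' u s t hu
        cases s with
        | nil => exact ⟨[], by simp at hu; simp [hu.1]⟩
        | cons a s => exact ⟨s ++ [i], by simp at hu; simp [hu.1]⟩
      obtain ⟨r, hr⟩ := hhead _ _ _ _ hv
      obtain ⟨r', hr'⟩ := hhead _ _ _ _ hw
      rw [key x x' r p hr, key y y' r' p' hr']
      omega

/-! ### Swappings as an equivalence relation on multisets of paths. -/

/-- A swapping of one of the six kinds, for two-state paths of length `T`. -/
def BasicSwap (T : ℕ) (P Q : Multiset (List (Fin 2))) : Prop :=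
  TypeOneSwap P Q ∨ CrossingSwap P Q ∨ TwoByTwoSwap P Q ∨ (4 ≤ T ∧ TypeFourSwap P Q) ∨
    TypeTwoSwap P Q ∨ SlidingSwap T 0 1 P Q

/-- A swapping of one of the six kinds applied to part of a multiset of paths of length `T`. -/
def SwapStep (T : ℕ) (P Q : Multiset (List (Fin 2))) : Prop :=
  ∃ P₀ Q₀ M, BasicSwap T P₀ Q₀ ∧ P = P₀ + M ∧ Q = Q₀ + M ∧
    (∀ l ∈ P, l.length = T) ∧ ∀ l ∈ Q, l.length = T

/-- Two multisets of paths joined by a sequence of swappings. -/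
def Linked (T : ℕ) : Multiset (List (Fin 2)) → Multiset (List (Fin 2)) → Prop :=
  Relation.EqvGen (SwapStep T)

namespace Linked

variable {T : ℕ} {P Q R M : Multiset (List (Fin 2))}

lemma refl (P : Multiset (List (Fin 2))) : Linked T P P := Relation.EqvGen.refl P

lemma symm (h : Linked T P Q) : Linked T Q P := Relation.EqvGen.symm _ _ h

lemma trans (h : Linked T P Q) (h' : Linked T Q R) : Linked T P R :=
  Relation.EqvGen.trans _ _ _ h h'

lemma of_basicSwap (h : BasicSwap T P Q) (hP : ∀ l ∈ P, l.length = T)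
    (hQ : ∀ l ∈ Q, l.length = T) : Linked T P Q :=
  Relation.EqvGen.rel _ _ ⟨P, Q, 0, h, by simp, by simp, hP, hQ⟩

lemma length_iff (h : Linked T P Q) : (∀ l ∈ P, l.length = T) ↔ ∀ l ∈ Q, l.length = T := by
  induction h with
  | rel _ _ h =>
    obtain ⟨_, _, _, _, _, _, h₁, h₂⟩ := h
    exact ⟨fun _ => h₂, fun _ => h₁⟩
  | refl => rfl
  | symm _ _ _ ih => exact ih.symm
  | trans _ _ _ _ _ ih ih' => exact ih.trans ih'

lemma add_right (h : Linked T P Q) (hM : ∀ l ∈ M, l.length = T) : Linked T (P + M) (Q + M) := by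
  induction h with
  | rel _ _ h =>
    obtain ⟨P₀, Q₀, N, h, rfl, rfl, h₁, h₂⟩ := h
    refine Relation.EqvGen.rel _ _ ⟨P₀, Q₀, N + M, h, by rw [add_assoc], by rw [add_assoc], ?_, ?_⟩
    · intro l hl
      exact (Multiset.mem_add.1 hl).elim (h₁ l) (hM l)
    · intro l hl
      exact (Multiset.mem_add.1 hl).elim (h₂ l) (hM l)
  | refl => exact refl _
  | symm _ _ _ ih => exact ih.symm
  | trans _ _ _ _ _ ih ih' => exact ih.trans ih'

lemma add {P' Q' : Multiset (List (Fin 2))} (h : Linked T P Q) (h' : Linked T P' Q')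
    (hP : ∀ l ∈ P, l.length = T) (hP' : ∀ l ∈ P', l.length = T) :
    Linked T (P + P') (Q + Q') := by
  have h₁ := h.add_right hP'
  have h₂ := h'.add_right (h.length_iff.1 hP)
  rw [add_comm P', add_comm Q'] at h₂
  exact h₁.trans h₂

lemma cons {a : List (Fin 2)} (h : Linked T P Q) (ha : a.length = T) :
    Linked T (a ::ₘ P) (a ::ₘ Q) := by
  have := h.add_right (M := {a}) (by simpa using ha)
  rwa [add_comm P, add_comm Q, Multiset.singleton_add, Multiset.singleton_add] at this

lemma pair {v w v' w' : List (Fin 2)} (h : Linked T {v} {v'}) (h' : Linked T {w} {w'})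
    (hv : v.length = T) (hw : w.length = T) : Linked T {v, w} {v', w'} := by
  have := h.add h' (by simpa using hv) (by simpa using hw)
  simpa using this

lemma crossing (i : Fin 2) {p q p' q' : List (Fin 2)} (hp : p.length = p'.length)
    (h : (p ++ i :: q).length = T) (h' : (p' ++ i :: q').length = T) :
    Linked T {p ++ i :: q, p' ++ i :: q'} {p ++ i :: q', p' ++ i :: q} := by
  refine of_basicSwap (Or.inr (Or.inl ⟨i, p, q, p', q', hp, rfl, rfl⟩)) ?_ ?_
  · simpa using ⟨by simpa using h, by simpa using h'⟩
  · simp at h h' ⊢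
    omega

end Linked

/-! ### Degree one moves: paths with the same transitions. -/

namespace SameTransitions

variable {S : Type} [DecidableEq S] {l l' l'' : List S}

lemma symm (h : SameTransitions l l') : SameTransitions l' l := fun i j => (h i j).symm

lemma trans (h : SameTransitions l l') (h' : SameTransitions l' l'') : SameTransitions l l'' :=
  fun i j => (h i j).trans (h' i j)

end SameTransitions

lemma numSwitches_congr {l l' : List (Fin 2)} (h : SameTransitions l l') :
    numSwitches l = numSwitches l' := by
  simp only [numSwitches, h 0 1, h 1 0]

lemma TypeOneSwap.sameTransitions {l l' : List (Fin 2)} (h : TypeOneSwap {l} {l'}) :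
    SameTransitions l l' ∧ l.length = l'.length := by
  obtain ⟨k, p, a, b, q, -, h₁, h₂⟩ := h
  rw [Multiset.singleton_inj] at h₁ h₂
  subst h₁ h₂
  refine ⟨fun i j => ?_, by simp; omega⟩
  have key : ∀ c d : List (Fin 2), numTransitions i j (p ++ k :: c ++ k :: d ++ k :: q) =
      numTransitions i j (p ++ [k]) + numTransitions i j (k :: c ++ [k]) +
        numTransitions i j (k :: d ++ [k]) + numTransitions i j (k :: q) := by
    intro c d
    have h₁ := numTransitions_append_cons i j p (c ++ k :: d ++ k :: q) k
    have h₂ := numTransitions_append_cons i j (k :: c) (d ++ k :: q) k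
    have h₃ := numTransitions_append_cons i j (k :: d) q k
    simp only [List.append_assoc, List.cons_append] at h₁ h₂ h₃ ⊢
    omega
  rw [key, key]
  omega

lemma TypeTwoSwap.sameTransitions {l l' : List (Fin 2)} (h : TypeTwoSwap {l} {l'}) :
    SameTransitions l l' ∧ l.length = l'.length := by
  obtain ⟨x, y, a, b, -, h₁, h₂⟩ := h
  rw [Multiset.singleton_inj] at h₁ h₂
  subst h₁ h₂
  refine ⟨fun i j => ?_, by simp; omega⟩
  have key : ∀ (z w : Fin 2) (c d : List (Fin 2)),
      numTransitions i j (z :: c ++ w :: d ++ [z]) =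
        numTransitions i j (z :: c ++ [w]) + numTransitions i j (w :: d ++ [z]) := by
    intro z w c d
    rw [List.append_assoc, List.cons_append (as := d), numTransitions_append_cons]
  rw [key, key, add_comm]

/-- Type I moves connect the paths with the same transitions that start in the same state;
`r` is a common initial part. -/
lemma linked_of_sameTransitions_cons {T : ℕ} (r u v : List (Fin 2)) (x : Fin 2)
    (h : SameTransitions (x :: u) (x :: v)) (hlen : u.length = v.length)
    (hT : (r ++ x :: u).length = T) : Linked T {r ++ x :: u} {r ++ x :: v} := by
  have aux : ∀ (n : ℕ) (r u v : List (Fin 2)) (x : Fin 2), u.length = n → v.length = n →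
      SameTransitions (x :: u) (x :: v) → (r ++ x :: u).length = T →
      Linked T {r ++ x :: u} {r ++ x :: v} := by
    intro n
    induction n with
    | zero =>
      intro r u v x hu hv _ _
      rw [List.length_eq_zero_iff] at hu hv
      subst hu hv
      exact Linked.refl _
    | succ n ih =>
      have same : ∀ (r u v : List (Fin 2)) (x y : Fin 2), u.length = n → v.length = n →
          SameTransitions (x :: y :: u) (x :: y :: v) → (r ++ x :: y :: u).length = T →
          Linked T {r ++ x :: y :: u} {r ++ x :: y :: v} := by
        intro r u v x y hu hv h hT
        have := ih (r ++ [x]) u v y hu hv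
          (fun i j => by simpa using h i j) (by simpa using hT)
        simpa using this
      have diff : ∀ (r u v : List (Fin 2)) (x y : Fin 2), x ≠ y → u.length = n → v.length = n →
          SameTransitions (x :: x :: u) (x :: y :: v) → (r ++ x :: x :: u).length = T →
          Linked T {r ++ x :: x :: u} {r ++ x :: y :: v} := by
        intro r u v x y hxy hu hv h hT
        have hpos : 0 < numTransitions x x (x :: y :: v) := by
          rw [← h x x]; simp
        obtain ⟨p, q, hpq⟩ := exists_append_of_numTransitions_pos _ _ hpos
        obtain ⟨p, rfl⟩ : ∃ p', p = x :: y :: p' := by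
          cases p with
          | nil => simp at hpq; exact absurd hpq.1.symm hxy
          | cons a p =>
            cases p with
            | nil => simp at hpq; exact absurd hpq.2.1.symm hxy
            | cons b p => simp at hpq; exact ⟨p, by rw [← hpq.1, ← hpq.2.1]⟩
        have hv' : v = p ++ x :: x :: q := by simpa using hpq
        -- One of the exchanged blocks is the single entry `x`: this brings a loop `xx` of the
        -- second path to the front, and both paths then begin alike.
        have hsw : TypeOneSwap {x :: y :: v} {x :: x :: y :: (p ++ x :: q)} :=
          ⟨x, [], y :: p, [], q, ⟨y, by simp, hxy.symm⟩, by simp [hv'], by simp⟩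
        have hsw' : TypeOneSwap {r ++ x :: y :: v} {r ++ x :: x :: y :: (p ++ x :: q)} :=
          ⟨x, r, y :: p, [], q, ⟨y, by simp, hxy.symm⟩, by simp [hv'], by simp⟩
        have hl : (y :: (p ++ x :: q)).length = n := by simp [hv'] at hv ⊢; omega
        refine (same r u (y :: (p ++ x :: q)) x x hu hl (h.trans hsw.sameTransitions.1) hT).trans ?_
        refine (Linked.of_basicSwap (Or.inl hsw') ?_ ?_).symm
        · simp at hT ⊢; omega
        · simp at hT hl ⊢; omega
      intro r u v x hu hv h hT
      cases u with
      | nil => simp at hu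
      | cons a u =>
        cases v with
        | nil => simp at hv
        | cons b v =>
          simp only [List.length_cons, Nat.add_right_cancel_iff] at hu hv
          by_cases hab : a = b
          · subst hab
            exact same r u v x a hu hv h hT
          · by_cases ha : a = x
            · subst ha
              exact diff r u v a b hab hu hv h hT
            · obtain rfl : b = x := by omega
              exact (diff r v u b a (Ne.symm ha) hv hu h.symm (by simp at hT ⊢; omega)).symm
  exact aux u.length r u v x rfl hlen.symm h hT

/-- Each switch changes the state by one up or down, so the counts telescope to last state minus
first. A path with equally many switches of both kinds is thus closed, as type II moves require. -/
lemma numTransitions_switch_getLast (x : Fin 2) (l : List (Fin 2)) :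
    numTransitions 0 1 (x :: l) + x.val =
      numTransitions 1 0 (x :: l) + ((x :: l).getLast (by simp)).val := by
  induction l generalizing x with
  | nil => simp
  | cons y l ih =>
    have := ih y
    simp only [numTransitions_cons_cons, List.getLast_cons_cons] at this ⊢
    fin_cases x <;> fin_cases y <;> simp at this ⊢ <;> omega

/-- A path with as many switches from `0` to `1` as from `1` to `0`, not all zero, may be
rotated by a type II move so as to start in the other state. -/
lemma exists_linked_cons_of_ne {T : ℕ} {x y : Fin 2} {u : List (Fin 2)} (hxy : x ≠ y)
    (hT : (x :: u).length = T)
    (hd : numTransitions 0 1 (x :: u) = numTransitions 1 0 (x :: u))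
    (hpos : 0 < numSwitches (x :: u)) :
    ∃ v, Linked T {x :: u} {y :: v} ∧ SameTransitions (x :: u) (y :: v) ∧
      (y :: v).length = T := by
  have hpos' : 0 < numTransitions x y (x :: u) := by
    unfold numSwitches at hpos
    obtain ⟨rfl, rfl⟩ | ⟨rfl, rfl⟩ : (x = 0 ∧ y = 1) ∨ (x = 1 ∧ y = 0) := by omega
    all_goals omega
  obtain ⟨p, q, hpq⟩ := exists_append_of_numTransitions_pos _ _ hpos'
  obtain ⟨a, ha⟩ : ∃ a, x :: a = p ++ [x] := by
    cases p with
    | nil => exact ⟨[], rfl⟩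
    | cons z p => simp at hpq; exact ⟨p ++ [x], by simp [hpq.1]⟩
  have hu : x :: u = x :: a ++ y :: q := by rw [hpq, ha]; simp
  obtain ⟨b, hb⟩ : ∃ b, y :: q = y :: b ++ [x] := by
    have hq := numTransitions_switch_getLast y q
    have ha' := numTransitions_switch_getLast x u
    have hgl : (x :: u).getLast (by simp) = (y :: q).getLast (by simp) := by simp [hu]
    have hl : (y :: q).getLast (by simp) = x := by omega
    rcases List.eq_nil_or_concat q with rfl | ⟨b, z, rfl⟩
    · exact absurd hl.symm hxy
    · exact ⟨b, by simp at hl; simp [hl]⟩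
  have hsw : TypeTwoSwap {x :: u} {y :: b ++ x :: a ++ [y]} :=
    ⟨x, y, a, b, hxy, by rw [hu, hb]; simp, rfl⟩
  obtain ⟨h₁, h₂⟩ := hsw.sameTransitions
  refine ⟨b ++ x :: a ++ [y], ?_, by simpa using h₁, by simpa [hT] using h₂.symm⟩
  refine Linked.of_basicSwap (Or.inr (Or.inr (Or.inr (Or.inr (Or.inl ?_))))) ?_ ?_
  · simpa using hsw
  · simpa using hT
  · have : (y :: b ++ x :: a ++ [y]).length = T := by rw [← h₂, hT]
    simpa using this

/-- Degree one moves connect the paths with the same transitions. -/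
lemma linked_of_sameTransitions {T : ℕ} (hT : 2 ≤ T) {u v : List (Fin 2)} (hu : u.length = T)
    (hv : v.length = T) (h : SameTransitions u v) : Linked T {u} {v} := by
  cases u with
  | nil => simp at hu; omega
  | cons x u =>
  cases v with
  | nil => simp at hv; omega
  | cons y v =>
  by_cases hxy : x = y
  · subst hxy
    exact linked_of_sameTransitions_cons [] u v x h (by simpa using hu.trans hv.symm) hu
  -- By alternation the switch out of the initial state is at least as frequent as the other one.
  -- With equal counts and different initial states both are equally frequent, so the path is a
  -- cycle and can be rotated.
  · have h₁ := numTransitions_switch_cons x u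
    have h₂ := numTransitions_switch_cons y v
    have h01 := h 0 1
    have h10 := h 1 0
    have hpos : 0 < numSwitches (x :: u) := by
      -- Without switches the paths would be constant in different states; equal loop counts then
      -- force length one, against `2 ≤ T`.
      by_contra h0
      have h0' : numSwitches (x :: u) = 0 := by omega
      have hu0 := eq_replicate_of_numSwitches_eq_zero h0'
      have hv0 := eq_replicate_of_numSwitches_eq_zero ((numSwitches_congr h).symm.trans h0')
      have hxx := h x x
      rw [hu0, hv0, numTransitions_replicate, numTransitions_replicate] at hxx
      simp [Ne.symm hxy] at hxx
      simp at hu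
      simp [hxx] at hu
      omega
    obtain ⟨w, hw, hs, hl⟩ := exists_linked_cons_of_ne hxy hu (by omega) hpos
    exact hw.trans (linked_of_sameTransitions_cons [] w v y (hs.symm.trans h)
      (by simpa using hl.trans hv.symm) hl)

/-! ### Levelling the switch counts by crossings. -/

/-- Two paths that differ by more than one in their numbers of switches can be made more similar
by a crossing, unless they differ by two and both have the same odd excess of switches. -/
lemma exists_linked_pair_sq_lt {T : ℕ} {v w : List (Fin 2)} (hT : 2 ≤ T)
    (hv : v.length = T) (hw : w.length = T) (h : numSwitches w + 2 ≤ numSwitches v)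
    (hex : ¬ (numSwitches v = numSwitches w + 2 ∧
      numTransitions 0 1 v + numTransitions 1 0 w = numTransitions 0 1 w + numTransitions 1 0 v ∧
      numTransitions 0 1 v ≠ numTransitions 1 0 v)) :
    ∃ v' w', Linked T {v, w} {v', w'} ∧
      numSwitches v' ^ 2 + numSwitches w' ^ 2 < numSwitches v ^ 2 + numSwitches w ^ 2 := by
  -- Crossing at a time up to which the first path has `d` switches more turns the counts `x`, `y`
  -- into `x - d`, `y + d`, so the sum of squares drops by `2 * d * (x - y - d)`.
  have cross : ∀ (d x y : ℕ) (a b : Fin 2) (u z : List (Fin 2)), (a :: u).length = T →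
      (b :: z).length = T → (a = b ↔ Even d) → 1 ≤ d → numSwitches (a :: u) = x →
      numSwitches (b :: z) = y → y + d < x →
      ∃ v' w', Linked T {a :: u, b :: z} {v', w'} ∧
        numSwitches v' ^ 2 + numSwitches w' ^ 2 < x ^ 2 + y ^ 2 := by
    intro d x y a b u z hu hz hd hd1 hx hy hxy
    obtain ⟨i, p, q, p', q', hpp, h₁, h₂, hs⟩ :=
      exists_meeting (v := u) (w := z) (x := a) (y := b) (by simp at hu hz; omega) hd (by omega)
    rw [h₁] at hu hx ⊢
    rw [h₂] at hz hy ⊢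
    refine ⟨_, _, Linked.crossing i hpp hu hz, ?_⟩
    have hc : ∀ r s : List (Fin 2),
        numSwitches (r ++ i :: s) = numSwitches (r ++ [i]) + numSwitches (i :: s) := by
      intro r s
      simp only [numSwitches]
      rw [numTransitions_append_cons 0 1 r, numTransitions_append_cons 1 0 r]
      omega
    rw [hc] at hx hy
    rw [hc p q', hc p' q]
    have e₁ : numSwitches (p ++ [i]) + numSwitches (i :: q') = y + d := by omega
    obtain ⟨e, rfl⟩ : ∃ e, x = y + d + e + 1 := ⟨x - (y + d) - 1, by omega⟩
    have e₂ : numSwitches (p' ++ [i]) + numSwitches (i :: q) = y + e + 1 := by omega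
    rw [e₁, e₂]
    nlinarith [Nat.mul_le_mul hd1 (Nat.zero_le e)]
  cases v with
  | nil => simp at hv; omega
  | cons a u =>
  cases w with
  | nil => simp at hw; omega
  | cons b z =>
  by_cases hab : a = b
  · by_cases h3 : numSwitches (b :: z) + 2 < numSwitches (a :: u)
    · exact cross 2 _ _ a b u z hv hw (by simp [hab]) (by omega) rfl rfl h3
    -- The lead is exactly two and the initial states agree, so by parity the excesses agree too.
    -- Outside the exceptional case the excess is zero, and a rotation makes the first path start in
    -- the other state, where a crossing with `d = 1` is possible.
    · have h₁ := numTransitions_switch_cons a u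
      have h₂ := numTransitions_switch_cons b z
      have hbal : numTransitions 0 1 (a :: u) = numTransitions 1 0 (a :: u) := by
        by_contra hne
        apply hex
        refine ⟨by omega, ?_, hne⟩
        unfold numSwitches at h h3
        omega
      obtain ⟨c, hc⟩ : ∃ c, a ≠ c := exists_ne a |>.imp fun _ => Ne.symm
      obtain ⟨t, ht, hs, hl⟩ := exists_linked_cons_of_ne hc hv hbal (by omega)
      obtain ⟨v', w', hl', hlt⟩ := cross 1 (numSwitches (a :: u)) _ c b t z hl hw
        (by simpa [← hab] using Ne.symm hc) le_rfl (numSwitches_congr hs).symm rfl (by omega)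
      exact ⟨v', w', (ht.pair (Linked.refl _) hv hw).trans hl', hlt⟩
  · exact cross 1 _ _ a b u z hv hw (by simpa using hab) le_rfl rfl rfl (by omega)

/-! ### Moving loops inside a path and between two opposite steps. -/

lemma numTransitions_append_cons_self {S : Type} [DecidableEq S] (a b : S) (p q : List S) (x : S) :
    numTransitions a b (p ++ x :: x :: q) =
      numTransitions a b (p ++ x :: q) + if x = a ∧ x = b then 1 else 0 := by
  rw [numTransitions_append_cons, numTransitions_append_cons _ _ p q, numTransitions_cons_cons]
  omega

/-- Deleting a loop destroys no transition between different states, so some `ij` survives and the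
loop can be reinserted beside it. -/
lemma exists_sameTransitions_append {S : Type} [DecidableEq S] {x i j : S} {l : List S}
    (hij : i ≠ j) (hx : 0 < numTransitions x x l) (h : 0 < numTransitions i j l) :
    ∃ p q, l.length = (p ++ i :: j :: q).length + 1 ∧
      ∀ a b, numTransitions a b l =
        numTransitions a b (p ++ i :: j :: q) + if x = a ∧ x = b then 1 else 0 := by
  obtain ⟨p, q, rfl⟩ := exists_append_of_numTransitions_pos _ _ hx
  have h' : 0 < numTransitions i j (p ++ x :: q) := by
    rw [numTransitions_append_cons_self, if_neg (fun hh => hij (hh.1.symm.trans hh.2))] at h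
    exact h
  obtain ⟨r, s, hrs⟩ := exists_append_of_numTransitions_pos _ _ h'
  refine ⟨r, s, ?_, fun a b => ?_⟩
  · rw [← hrs]; simp; omega
  · rw [← hrs, numTransitions_append_cons_self]

lemma exists_sameTransitions_left {S : Type} [DecidableEq S] {i j : S} {l : List S}
    (hij : i ≠ j) (hx : 0 < numTransitions i i l) (h : 0 < numTransitions i j l) :
    ∃ p q, l.length = (p ++ [i, i, j] ++ q).length ∧ SameTransitions l (p ++ [i, i, j] ++ q) := by
  obtain ⟨p, q, hl, hs⟩ := exists_sameTransitions_append hij hx h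
  refine ⟨p, q, by simp at hl ⊢; omega, fun a b => ?_⟩
  rw [hs a b]
  simp [numTransitions_append_cons_self]

lemma exists_sameTransitions_right {S : Type} [DecidableEq S] {i j : S} {l : List S}
    (hij : i ≠ j) (hx : 0 < numTransitions j j l) (h : 0 < numTransitions i j l) :
    ∃ p q, l.length = (p ++ [i, j, j] ++ q).length ∧ SameTransitions l (p ++ [i, j, j] ++ q) := by
  obtain ⟨p, q, hl, hs⟩ := exists_sameTransitions_append hij hx h
  refine ⟨p, q, by simp at hl ⊢; omega, fun a b => ?_⟩
  rw [hs a b]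
  have := numTransitions_append_cons_self a b (p ++ [i]) q j
  simp at this ⊢
  rw [this]

lemma numTransitions_step {S : Type} [DecidableEq S] (a b i j : S) (m n : ℕ) :
    numTransitions a b (List.replicate (m + 1) i ++ List.replicate (n + 1) j) =
      (if i = a ∧ i = b then m else 0) + (if i = a ∧ j = b then 1 else 0) +
        if j = a ∧ j = b then n else 0 := by
  have h : List.replicate (m + 1) i ++ List.replicate (n + 1) j =
      List.replicate m i ++ i :: j :: List.replicate n j := by
    rw [List.replicate_succ', List.replicate_succ]; simp
  rw [h, numTransitions_replicate_append, numTransitions_cons_cons, ← List.replicate_succ,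
    numTransitions_replicate, Nat.add_sub_cancel]
  omega

lemma sameTransitions_of_three {u v : List (Fin 2)} (hlen : u.length = v.length)
    (h00 : numTransitions 0 0 u = numTransitions 0 0 v)
    (h01 : numTransitions 0 1 u = numTransitions 0 1 v)
    (h10 : numTransitions 1 0 u = numTransitions 1 0 v) : SameTransitions u v := by
  have hu := sum_numTransitions u
  have hv := sum_numTransitions v
  have h11 : numTransitions 1 1 u = numTransitions 1 1 v := by omega
  intro i j
  fin_cases i <;> fin_cases j <;> assumption

/-- `i^(A+1) j^x, j^(B+1) i^y` exchange a transition `ii` with a transition `jj`. -/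
lemma linked_opposite_steps {T A B x y : ℕ} {i j : Fin 2} (hij : i ≠ j) (hA : 1 ≤ A) (hB : 1 ≤ B)
    (hx : 1 ≤ x) (hy : 1 ≤ y) (hAT : A + 1 + x = T) (hBT : B + 1 + y = T) :
    Linked T {List.replicate (A + 1) i ++ List.replicate x j,
        List.replicate (B + 1) j ++ List.replicate y i}
      {List.replicate A i ++ List.replicate (x + 1) j,
        List.replicate B j ++ List.replicate (y + 1) i} := by
  -- Crossing in state `j` turns the two opposite steps into a path that leaves `i` and returns, and
  -- a constant path.
  have cross : ∀ {i j : Fin 2} {a d y : ℕ}, 1 ≤ d → a + d + y = T →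
      Linked T {List.replicate a i ++ List.replicate (d + y) j,
          List.replicate (a + d) j ++ List.replicate y i}
        {List.replicate a i ++ List.replicate d j ++ List.replicate y i, List.replicate T j} := by
    intro i j a d y hd hT
    obtain ⟨d, rfl⟩ : ∃ e, d = e + 1 := ⟨d - 1, by omega⟩
    have e₁ : List.replicate a i ++ List.replicate (d + 1 + y) j =
        (List.replicate a i ++ List.replicate d j) ++ j :: List.replicate y j := by
      rw [show d + 1 + y = d + (y + 1) by omega, ← List.replicate_append_replicate,
        List.replicate_succ, List.append_assoc]
    have e₂ : List.replicate (a + (d + 1)) j ++ List.replicate y i =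
        List.replicate (a + d) j ++ j :: List.replicate y i := by
      rw [← add_assoc, List.replicate_succ']; simp
    have e₃ : List.replicate a i ++ List.replicate (d + 1) j ++ List.replicate y i =
        (List.replicate a i ++ List.replicate d j) ++ j :: List.replicate y i := by
      rw [List.replicate_succ']; simp
    have e₄ : List.replicate T j = List.replicate (a + d) j ++ j :: List.replicate y j := by
      rw [← List.replicate_succ, List.replicate_append_replicate, ← hT]; congr 1; omega
    rw [e₁, e₂, e₃, e₄]
    exact Linked.crossing j (by simp) (by simp; omega) (by simp; omega)
  have shift : ∀ {i j : Fin 2} {a d y : ℕ}, i ≠ j → 1 ≤ a → 1 ≤ d → 1 ≤ y → a + 1 + d + y = T →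
      Linked T {List.replicate (a + 1) i ++ List.replicate (d + y) j,
          List.replicate (a + 1 + d) j ++ List.replicate y i}
        {List.replicate a i ++ List.replicate (d + y + 1) j,
          List.replicate (a + d) j ++ List.replicate (y + 1) i} := by
    intro i j a d y hij ha hd hy hT
    -- In the returning path, degree one moves carry a loop `ii` from the first block of `i` to the
    -- last; crossing back then gives the desired steps.
    refine (cross hd hT).trans (Linked.trans ?_ (cross (y := y + 1) hd (by omega)).symm)
    refine Linked.pair ?_ (Linked.refl _) (by simp; omega) (by simp)
    refine linked_of_sameTransitions (by omega) (by simp; omega) (by simp; omega) ?_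
    obtain ⟨a, rfl⟩ : ∃ e, a = e + 1 := ⟨a - 1, by omega⟩
    obtain ⟨d, rfl⟩ : ∃ e, d = e + 1 := ⟨d - 1, by omega⟩
    obtain ⟨y, rfl⟩ : ∃ e, y = e + 1 := ⟨y - 1, by omega⟩
    have key : ∀ (b z : ℕ) (s t : Fin 2), numTransitions s t
        (List.replicate (b + 1) i ++ List.replicate (d + 1) j ++ List.replicate (z + 1) i) =
        numTransitions s t (List.replicate (b + 1) i ++ List.replicate (d + 1) j) +
          numTransitions s t (List.replicate (d + 1) j ++ List.replicate (z + 1) i) -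
          (if j = s ∧ j = t then d else 0) := by
      intro b z s t
      have e : ∀ l : List (Fin 2), List.replicate (d + 1) j ++ l = List.replicate d j ++ j :: l := by
        intro l
        rw [List.replicate_succ' (n := d)]; simp
      have h₁ := numTransitions_append_cons s t (List.replicate (b + 1) i ++ List.replicate d j)
        (List.replicate (z + 1) i) j
      have h₂ := numTransitions_append_cons s t (List.replicate d j)
        (List.replicate (z + 1) i) j
      rw [← List.replicate_succ', numTransitions_replicate, ← e] at h₂
      rw [List.append_assoc, ← e, ← List.append_assoc, List.append_assoc _ _ [j],
        ← List.replicate_succ'] at h₁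
      rw [h₁, h₂]
      split_ifs <;> omega
    intro s t
    rw [key (a + 1) y, key a (y + 1)]
    simp only [numTransitions_step]
    split_ifs <;> omega
  rcases lt_trichotomy A B with hlt | rfl | hlt
  · obtain ⟨d, rfl⟩ : ∃ d, B = A + d := ⟨B - A, by omega⟩
    have := shift hij hA (show 1 ≤ d by omega) hy (by omega)
    rw [show x = d + y by omega, show A + d + 1 = A + 1 + d by omega]
    exact this
  -- Here the two paths are in opposite states at every time, so no crossing exists; a 2 by 2 swap
  -- at times `A` and `A + 1` does the exchange.
  · obtain rfl : x = y := by omega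
    have e₁ : ∀ k : Fin 2, ∀ n, List.replicate (n + 1) k = List.replicate n k ++ [k] :=
      fun _ _ => List.replicate_succ'
    refine Linked.of_basicSwap (Or.inr (Or.inr (Or.inl ⟨i, j, A, A + 1, _, _, hij, by omega,
      ⟨hA, ?_, ?_⟩, ⟨hA, ?_, ?_⟩, Or.inl ⟨⟨by omega, ?_, ?_⟩, ⟨by omega, ?_, ?_⟩⟩, rfl, ?_⟩)))
        ?_ ?_
    · rw [List.getElem?_append_left (by simp)]; simp
    · rw [List.getElem?_append_left (by simp)]; simp
    · rw [List.getElem?_append_left (by simp)]; simp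
    · rw [List.getElem?_append_left (by simp)]; simp
    · rw [List.getElem?_append_left (by simp)]; simp
    · rw [List.getElem?_append_right (by simp)]; simp [List.getElem?_replicate]; omega
    · rw [List.getElem?_append_left (by simp)]; simp
    · rw [List.getElem?_append_right (by simp)]; simp [List.getElem?_replicate]; omega
    · have hs : ∀ k l : Fin 2, spliceAt (A + 1)
          (spliceAt A (List.replicate (A + 1) k ++ List.replicate x l)
            (List.replicate (A + 1) l ++ List.replicate x k))
          (spliceAt A (List.replicate (A + 1) l ++ List.replicate x k)
            (List.replicate (A + 1) k ++ List.replicate x l)) =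
          List.replicate A k ++ List.replicate (x + 1) l := by
        intro k l
        have h₁ : ∀ k l m n : Fin 2, spliceAt A (List.replicate (A + 1) k ++ List.replicate x m)
            (List.replicate (A + 1) l ++ List.replicate x n) =
            List.replicate A k ++ l :: List.replicate x n := by
          intro k l m n
          unfold spliceAt
          rw [e₁, e₁, List.append_assoc, List.append_assoc, List.take_append_of_le_length (by simp),
            List.drop_append_of_le_length (by simp)]
          simp
        rw [h₁, h₁]
        unfold spliceAt
        rw [List.replicate_succ, List.take_append, List.drop_append]
        simp
      rw [hs, hs]
    · simp; omega
    · simp; omega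
  · obtain ⟨d, rfl⟩ : ∃ d, A = B + d := ⟨A - B, by omega⟩
    have := shift hij.symm hB (show 1 ≤ d by omega) hx (by omega)
    rw [show y = d + x by omega, show B + d + 1 = B + 1 + d by omega, Multiset.pair_comm,
      Multiset.pair_comm (List.replicate (B + d) i ++ _)]
    exact this

/-! ### Invariance of the total transition counts under swappings. -/

/-- The total number of transitions from `i` to `j` in a multiset of paths. -/
def totalTransitions (i j : Fin 2) (P : Multiset (List (Fin 2))) : ℕ :=
  (P.map (numTransitions i j)).sum

@[simp] lemma totalTransitions_zero (i j : Fin 2) : totalTransitions i j 0 = 0 := by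
  simp [totalTransitions]

@[simp] lemma totalTransitions_cons (i j : Fin 2) (l : List (Fin 2))
    (P : Multiset (List (Fin 2))) :
    totalTransitions i j (l ::ₘ P) = numTransitions i j l + totalTransitions i j P := by
  simp [totalTransitions]

@[simp] lemma totalTransitions_singleton (i j : Fin 2) (l : List (Fin 2)) :
    totalTransitions i j {l} = numTransitions i j l := by
  simp [totalTransitions]

@[simp] lemma totalTransitions_add (i j : Fin 2) (P Q : Multiset (List (Fin 2))) :
    totalTransitions i j (P + Q) = totalTransitions i j P + totalTransitions i j Q := by
  simp [totalTransitions]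

lemma totalTransitions_map_reverse (i j : Fin 2) (P : Multiset (List (Fin 2))) :
    totalTransitions i j (P.map List.reverse) = totalTransitions j i P := by
  simp [totalTransitions, numTransitions_reverse]

lemma CrossingSwap.totalTransitions_eq {P Q : Multiset (List (Fin 2))} (h : CrossingSwap P Q)
    (i j : Fin 2) : totalTransitions i j P = totalTransitions i j Q := by
  obtain ⟨k, p, q, p', q', -, rfl, rfl⟩ := h
  simp only [Multiset.insert_eq_cons, totalTransitions_cons, totalTransitions_singleton]
  rw [numTransitions_append_cons _ _ p q, numTransitions_append_cons _ _ p' q',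
    numTransitions_append_cons _ _ p q', numTransitions_append_cons _ _ p' q]
  omega

lemma HasEdge.exists_append {S : Type} {l : List S} {t : ℕ} {x y : S} (h : HasEdge l t x y) :
    ∃ p q, l = p ++ x :: y :: q ∧ p.length + 1 = t := by
  obtain ⟨ht, h₁, h₂⟩ := h
  obtain ⟨t, rfl⟩ : ∃ s, t = s + 1 := ⟨t - 1, by omega⟩
  rw [Nat.add_sub_cancel] at h₁
  obtain ⟨hl₁, e₁⟩ := List.getElem?_eq_some_iff.1 h₁
  obtain ⟨hl₂, e₂⟩ := List.getElem?_eq_some_iff.1 h₂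
  refine ⟨l.take t, l.drop (t + 1 + 1), ?_, by simp; omega⟩
  rw [← e₁, ← e₂, ← List.drop_eq_getElem_cons, ← List.drop_eq_getElem_cons, List.take_append_drop]

/-- Exchanging the parts after time `t` affects only the two transitions at time `t`. -/
lemma numTransitions_spliceAt_add {S : Type} [DecidableEq S] (i j : S) {l l' : List S} {t : ℕ}
    {x y x' y' : S} (h : HasEdge l t x y) (h' : HasEdge l' t x' y') :
    numTransitions i j (spliceAt t l l') + numTransitions i j (spliceAt t l' l) +
        (if x = i ∧ y = j then 1 else 0) + (if x' = i ∧ y' = j then 1 else 0) =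
      numTransitions i j l + numTransitions i j l' +
        (if x = i ∧ y' = j then 1 else 0) + (if x' = i ∧ y = j then 1 else 0) := by
  obtain ⟨p, q, rfl, hp⟩ := h.exists_append
  obtain ⟨p', q', rfl, hp'⟩ := h'.exists_append
  have key : ∀ (r s r' s' : List S) (z w z' w' : S), r.length + 1 = t → r'.length + 1 = t →
      spliceAt t (r ++ z :: w :: s) (r' ++ z' :: w' :: s') = r ++ z :: w' :: s' := by
    intro r s r' s' z w z' w' hr hr'
    unfold spliceAt
    rw [show r ++ z :: w :: s = (r ++ [z]) ++ w :: s by simp,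
      show r' ++ z' :: w' :: s' = (r' ++ [z']) ++ w' :: s' by simp,
      List.take_left' (by simpa using hr), List.drop_left' (by simpa using hr')]
    simp
  rw [key p q p' q' x y x' y' hp hp', key p' q' p q x' y' x y hp' hp]
  simp only [numTransitions_append_cons_cons]
  omega

lemma getElem?_spliceAt {S : Type} {l l' : List S} {t : ℕ} (ht : t ≤ l.length) (k : ℕ) :
    (spliceAt t l l')[k]? = if k < t then l[k]? else l'[k]? := by
  unfold spliceAt
  split_ifs with hk
  · rw [List.getElem?_append_left (by simp; omega), List.getElem?_take_of_lt hk]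
  · rw [List.getElem?_append_right (by simp; omega), List.getElem?_drop, List.length_take]
    congr 1
    omega

lemma HasEdge.lt_length {S : Type} {l : List S} {t : ℕ} {x y : S} (h : HasEdge l t x y) :
    t < l.length :=
  (List.getElem?_eq_some_iff.1 h.2.2).1

lemma HasEdge.spliceAt_left {S : Type} {l l' : List S} {s t : ℕ} {x y : S} (h : HasEdge l s x y)
    (hst : s < t) (ht : t ≤ l.length) : HasEdge (spliceAt t l l') s x y := by
  obtain ⟨h₀, h₁, h₂⟩ := h
  exact ⟨h₀, by rw [getElem?_spliceAt ht, if_pos (by omega), h₁],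
    by rw [getElem?_spliceAt ht, if_pos (by omega), h₂]⟩

lemma HasEdge.spliceAt_right {S : Type} {l l' : List S} {s t : ℕ} {x y : S} (h : HasEdge l' s x y)
    (hst : t < s) (ht : t ≤ l.length) : HasEdge (spliceAt t l l') s x y := by
  obtain ⟨h₀, h₁, h₂⟩ := h
  exact ⟨h₀, by rw [getElem?_spliceAt ht, if_neg (by omega), h₁],
    by rw [getElem?_spliceAt ht, if_neg (by omega), h₂]⟩

lemma TwoByTwoSwap.totalTransitions_eq {P Q : Multiset (List (Fin 2))} (h : TwoByTwoSwap P Q)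
    (a b : Fin 2) : totalTransitions a b P = totalTransitions a b Q := by
  obtain ⟨i, j, t₀, t₁, v, w, hij, ht, hv, hw, h, rfl, rfl⟩ := h
  have key : ∀ x y x' y' : Fin 2, HasEdge v t₁ x y → HasEdge w t₁ x' y' →
      numTransitions a b (spliceAt t₁ (spliceAt t₀ v w) (spliceAt t₀ w v)) +
        numTransitions a b (spliceAt t₁ (spliceAt t₀ w v) (spliceAt t₀ v w)) +
        (if x = a ∧ y = b then 1 else 0) + (if x' = a ∧ y' = b then 1 else 0) =
      numTransitions a b (spliceAt t₀ v w) + numTransitions a b (spliceAt t₀ w v) +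
        (if x = a ∧ y' = b then 1 else 0) + (if x' = a ∧ y = b then 1 else 0) := by
    intro x y x' y' h₁ h₂
    -- The exchange at `t₀` preserves both transitions at time `t₁`, but for `t₀ < t₁` it hands each
    -- of them to the other path.
    rcases lt_or_gt_of_ne ht with hlt | hlt
    · have := numTransitions_spliceAt_add a b
        (h₂.spliceAt_right (l := v) hlt hv.lt_length.le)
        (h₁.spliceAt_right (l := w) hlt hw.lt_length.le)
      omega
    · exact numTransitions_spliceAt_add a b
        (h₁.spliceAt_left (l' := w) hlt hv.lt_length.le)
        (h₂.spliceAt_left (l' := v) hlt hw.lt_length.le)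
  have h₀ := numTransitions_spliceAt_add a b hv hw
  simp only [Multiset.insert_eq_cons, totalTransitions_cons, totalTransitions_singleton]
  rcases h with ⟨h₁, h₂⟩ | ⟨h₁, h₂⟩
  · have := key _ _ _ _ h₁ h₂
    omega
  · have := key _ _ _ _ h₁ h₂
    omega

lemma numTransitions_append_left_loop {S : Type} [DecidableEq S] (a b i j : S) (p q : List S) :
    numTransitions a b (p ++ [i, i, j] ++ q) =
      numTransitions a b (p ++ i :: j :: q) + if i = a ∧ i = b then 1 else 0 := by
  simp [numTransitions_append_cons_self]

lemma numTransitions_append_right_loop {S : Type} [DecidableEq S] (a b i j : S) (p q : List S) :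
    numTransitions a b (p ++ [i, j, j] ++ q) =
      numTransitions a b (p ++ i :: j :: q) + if j = a ∧ j = b then 1 else 0 := by
  have := numTransitions_append_cons_self a b (p ++ [i]) q j
  simpa using this

lemma TypeFourSwap.totalTransitions_eq {P Q : Multiset (List (Fin 2))} (h : TypeFourSwap P Q)
    (a b : Fin 2) : totalTransitions a b P = totalTransitions a b Q := by
  obtain ⟨i, j, p, q, p', q', -, rfl, rfl⟩ := h
  simp only [Multiset.insert_eq_cons, totalTransitions_cons, totalTransitions_singleton,
    numTransitions_append_left_loop, numTransitions_append_right_loop]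
  omega

lemma SlidingSwap.totalTransitions_eq {T : ℕ} {i j : Fin 2} {P Q : Multiset (List (Fin 2))}
    (h : SlidingSwap T i j P Q) (s t : Fin 2) : totalTransitions s t P = totalTransitions s t Q := by
  obtain ⟨a, b, u, ha, hab, hT, hbu, hu, W₁, W₂, h₁, h₂, h⟩ := h
  have step : ∀ (c : ℕ) (s t : Fin 2), 1 ≤ c → c ≤ T - 1 →
      numTransitions s t (stepPath T i j c) = (if i = s ∧ i = t then c - 1 else 0) +
        (if i = s ∧ j = t then 1 else 0) + if j = s ∧ j = t then T - c - 1 else 0 := by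
    intro c s t h₁ h₂
    have := numTransitions_step s t i j (c - 1) (T - c - 1)
    rwa [show c - 1 + 1 = c by omega, show T - c - 1 + 1 = T - c by omega] at this
  -- The loops balance because `a' + b' = a + b + (T - 1)`: the `T - 1` loops of the constant path
  -- in `i` pass to the two step paths.
  have key : ∀ s t : Fin 2, totalTransitions s t W₁ = totalTransitions s t W₂ := by
    intro s t
    subst h₁ h₂
    simp only [Multiset.insert_eq_cons, totalTransitions_cons, totalTransitions_singleton]
    rw [step a s t (by omega) (by omega), step b s t (by omega) (by omega),
      step _ s t (by omega) (by omega), step _ s t (by omega) (by omega),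
      numTransitions_replicate, numTransitions_replicate]
    split_ifs <;> omega
  rcases h with ⟨rfl, rfl⟩ | ⟨rfl, rfl⟩
  · exact key s t
  · rw [totalTransitions_map_reverse, totalTransitions_map_reverse, key]

lemma TypeOneSwap.totalTransitions_eq {P Q : Multiset (List (Fin 2))} (h : TypeOneSwap P Q)
    (i j : Fin 2) : totalTransitions i j P = totalTransitions i j Q := by
  obtain ⟨k, p, a, b, q, h, rfl, rfl⟩ := h
  simpa using (TypeOneSwap.sameTransitions ⟨k, p, a, b, q, h, rfl, rfl⟩).1 i j

lemma TypeTwoSwap.totalTransitions_eq {P Q : Multiset (List (Fin 2))} (h : TypeTwoSwap P Q)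
    (i j : Fin 2) : totalTransitions i j P = totalTransitions i j Q := by
  obtain ⟨x, y, a, b, h, rfl, rfl⟩ := h
  simpa using (TypeTwoSwap.sameTransitions ⟨x, y, a, b, h, rfl, rfl⟩).1 i j

lemma BasicSwap.totalTransitions_eq {T : ℕ} {P Q : Multiset (List (Fin 2))} (h : BasicSwap T P Q)
    (i j : Fin 2) : totalTransitions i j P = totalTransitions i j Q := by
  rcases h with h | h | h | ⟨-, h⟩ | h | h <;> exact h.totalTransitions_eq i j

lemma BasicSwap.card_eq {T : ℕ} {P Q : Multiset (List (Fin 2))} (h : BasicSwap T P Q) :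
    P.card = Q.card ∧ P.card ≤ 3 := by
  rcases h with ⟨_, _, _, _, _, _, rfl, rfl⟩ | ⟨_, _, _, _, _, _, rfl, rfl⟩ |
    ⟨_, _, _, _, _, _, _, _, _, _, _, rfl, rfl⟩ | ⟨-, _, _, _, _, _, _, _, rfl, rfl⟩ |
    ⟨_, _, _, _, _, rfl, rfl⟩ | ⟨_, _, _, _, _, _, _, _, _, _, rfl, rfl, ⟨rfl, rfl⟩ | ⟨rfl, rfl⟩⟩ <;>
    simp

namespace Linked

variable {T : ℕ} {P Q : Multiset (List (Fin 2))}

lemma totalTransitions_eq (h : Linked T P Q) (i j : Fin 2) :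
    totalTransitions i j P = totalTransitions i j Q := by
  induction h with
  | rel _ _ h =>
    obtain ⟨_, _, _, h, rfl, rfl, -⟩ := h
    simp [h.totalTransitions_eq i j]
  | refl => rfl
  | symm _ _ _ ih => exact ih.symm
  | trans _ _ _ _ _ ih ih' => exact ih.trans ih'

lemma card_eq (h : Linked T P Q) : P.card = Q.card := by
  induction h with
  | rel _ _ h =>
    obtain ⟨_, _, _, h, rfl, rfl, -⟩ := h
    simp [h.card_eq.1]
  | refl => rfl
  | symm _ _ _ ih => exact ih.symm
  | trans _ _ _ _ _ ih ih' => exact ih.trans ih'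

end Linked

/-! ### Trading loops between paths and gathering them. -/

/-- The numbers of switches from `0` to `1` and from `1` to `0`. -/
def switchType (l : List (Fin 2)) : ℕ × ℕ := (numTransitions 0 1 l, numTransitions 1 0 l)

/-- For `T = 3` the two paths are just `iij` and `ijj`, and the swapping gives back the same
multiset; hence no assumption `4 ≤ T`. -/
lemma linked_typeFour {T : ℕ} {i j : Fin 2} (hij : i ≠ j) {p q p' q' : List (Fin 2)}
    (h : (p ++ [i, i, j] ++ q).length = T) (h' : (p' ++ [i, j, j] ++ q').length = T) :
    Linked T {p ++ [i, i, j] ++ q, p' ++ [i, j, j] ++ q'}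
      {p ++ [i, j, j] ++ q, p' ++ [i, i, j] ++ q'} := by
  by_cases hT : 4 ≤ T
  · refine Linked.of_basicSwap
      (Or.inr (Or.inr (Or.inr (Or.inl ⟨hT, i, j, p, q, p', q', hij, rfl, rfl⟩)))) ?_ ?_
    · simp at h h' ⊢; omega
    · simp at h h' ⊢; omega
  · simp only [List.length_append, List.length_cons, List.length_nil] at h h'
    obtain rfl : p = [] := List.length_eq_zero_iff.1 (by omega)
    obtain rfl : p' = [] := List.length_eq_zero_iff.1 (by omega)
    obtain rfl : q = [] := List.length_eq_zero_iff.1 (by omega)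
    obtain rfl : q' = [] := List.length_eq_zero_iff.1 (by omega)
    rw [Multiset.pair_comm]
    exact Linked.refl _

/-- A path with one switch, from `i` to `j`, is determined by its transitions. -/
lemma sameTransitions_step {i j : Fin 2} (hij : i ≠ j) {l : List (Fin 2)}
    (h : numTransitions i j l = 1) (h' : numTransitions j i l = 0) :
    SameTransitions l (List.replicate (numTransitions i i l + 1) i ++
      List.replicate (numTransitions j j l + 1) j) := by
  have hs := numTransitions_step (i := i) (j := j) (m := numTransitions i i l)
    (n := numTransitions j j l)
  obtain ⟨rfl, rfl⟩ | ⟨rfl, rfl⟩ : (i = 0 ∧ j = 1) ∨ (i = 1 ∧ j = 0) := by omega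
  all_goals
    intro s t
    rw [hs]
    fin_cases s <;> fin_cases t <;> simp [h, h']

lemma linked_step {T : ℕ} (hT : 2 ≤ T) {i j : Fin 2} (hij : i ≠ j) {l : List (Fin 2)}
    (hl : l.length = T) (h : numTransitions i j l = 1) (h' : numTransitions j i l = 0) :
    Linked T {l} {List.replicate (numTransitions i i l + 1) i ++
      List.replicate (numTransitions j j l + 1) j} ∧
      numTransitions i i l + numTransitions j j l + 2 = T := by
  have hsum : numTransitions i i l + numTransitions j j l + 2 = T := by
    have := sum_numTransitions l
    obtain ⟨rfl, rfl⟩ | ⟨rfl, rfl⟩ : (i = 0 ∧ j = 1) ∨ (i = 1 ∧ j = 0) := by omega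
    all_goals omega
  exact ⟨linked_of_sameTransitions hT hl (by simp; omega) (sameTransitions_step hij h h'), hsum⟩

/-- Two non-constant paths can exchange a transition `00` of the first path with a transition `11`
of the second one. -/
lemma exists_linked_exchange {T : ℕ} (hT : 3 ≤ T) {v w : List (Fin 2)}
    (hv : v.length = T) (hw : w.length = T) (hv1 : 1 ≤ numSwitches v) (hw1 : 1 ≤ numSwitches w)
    (h00 : 1 ≤ numTransitions 0 0 v) (h11 : 1 ≤ numTransitions 1 1 w) :
    ∃ v' w', Linked T {v, w} {v', w'} ∧ switchType v' = switchType v ∧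
      switchType w' = switchType w ∧ numTransitions 0 0 v' + 1 = numTransitions 0 0 v := by
  have hT2 : 2 ≤ T := by omega
  have hvd := numTransitions_switch_le v
  have hwd := numTransitions_switch_le w
  unfold numSwitches at hv1 hw1
  unfold switchType
  -- If both paths have a switch of the same kind, degree one moves bring the loops beside it and a
  -- type (iv) swapping exchanges them.
  by_cases h01 : 1 ≤ numTransitions 0 1 v ∧ 1 ≤ numTransitions 0 1 w
  · obtain ⟨p, q, hl, hs⟩ := exists_sameTransitions_left (by simp) h00 h01.1
    obtain ⟨p', q', hl', hs'⟩ := exists_sameTransitions_right (by simp) h11 h01.2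
    rw [hv] at hl
    rw [hw] at hl'
    refine ⟨_, _, (Linked.pair (linked_of_sameTransitions hT2 hv hl.symm hs)
      (linked_of_sameTransitions hT2 hw hl'.symm hs') hv hw).trans
      (linked_typeFour (by simp) hl.symm hl'.symm), ?_, ?_, ?_⟩
    all_goals simp [hs _ _, hs' _ _, numTransitions_append_left_loop,
      numTransitions_append_right_loop, -List.append_assoc]
  by_cases h10 : 1 ≤ numTransitions 1 0 v ∧ 1 ≤ numTransitions 1 0 w
  · obtain ⟨p, q, hl, hs⟩ := exists_sameTransitions_right (by simp) h00 h10.1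
    obtain ⟨p', q', hl', hs'⟩ := exists_sameTransitions_left (by simp) h11 h10.2
    rw [hv] at hl
    rw [hw] at hl'
    have hf := linked_typeFour (by simp) hl'.symm hl.symm
    rw [Multiset.pair_comm, Multiset.pair_comm (p' ++ _ ++ _)] at hf
    refine ⟨_, _, (Linked.pair (linked_of_sameTransitions hT2 hv hl.symm hs)
      (linked_of_sameTransitions hT2 hw hl'.symm hs') hv hw).trans hf, ?_, ?_, ?_⟩
    all_goals simp [hs _ _, hs' _ _, numTransitions_append_left_loop,
      numTransitions_append_right_loop, -List.append_assoc]
  -- With no common kind of switch, alternation leaves exactly one switch in each path, in opposite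
  -- directions.
  by_cases hv01 : 1 ≤ numTransitions 0 1 v
  · obtain ⟨l₁, e₁⟩ := linked_step hT2 (i := 0) (j := 1) (by simp) hv (by omega) (by omega)
    obtain ⟨l₂, e₂⟩ := linked_step hT2 (i := 1) (j := 0) (by simp) hw (by omega) (by omega)
    refine ⟨_, _, (l₁.pair l₂ hv hw).trans (linked_opposite_steps (by simp) h00 h11 (by omega)
      (by omega) (by omega) (by omega)), ?_, ?_, ?_⟩
    all_goals
      obtain ⟨a, ha⟩ : ∃ a, numTransitions 0 0 v = a + 1 := ⟨_, (Nat.sub_add_cancel h00).symm⟩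
      obtain ⟨b, hb⟩ : ∃ b, numTransitions 1 1 w = b + 1 := ⟨_, (Nat.sub_add_cancel h11).symm⟩
      simp only [ha, hb, numTransitions_step]
      simp
      try omega
  · obtain ⟨l₁, e₁⟩ := linked_step hT2 (i := 1) (j := 0) (by simp) hv (by omega) (by omega)
    obtain ⟨l₂, e₂⟩ := linked_step hT2 (i := 0) (j := 1) (by simp) hw (by omega) (by omega)
    have ho := (linked_opposite_steps (T := T) (i := 1) (j := 0) (A := numTransitions 1 1 v + 1)
      (B := numTransitions 0 0 w + 1) (x := numTransitions 0 0 v) (y := numTransitions 1 1 w)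
      (by simp) (by omega) (by omega) h00 h11 (by omega) (by omega)).symm
    refine ⟨_, _, (l₁.pair l₂ hv hw).trans ho, ?_, ?_, ?_⟩
    all_goals
      obtain ⟨a, ha⟩ : ∃ a, numTransitions 0 0 v = a + 1 := ⟨_, (Nat.sub_add_cancel h00).symm⟩
      obtain ⟨b, hb⟩ : ∃ b, numTransitions 1 1 w = b + 1 := ⟨_, (Nat.sub_add_cancel h11).symm⟩
      simp only [ha, hb, numTransitions_step]
      simp
      try omega

lemma exists_mem_switchType_eq {W W' : Multiset (List (Fin 2))}
    (h : W'.map switchType = W.map switchType) {w : List (Fin 2)} (hw : w ∈ W') :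
    ∃ u ∈ W, switchType u = switchType w :=
  Multiset.mem_map.1 (h ▸ Multiset.mem_map_of_mem _ hw)

lemma numSwitches_eq_of_switchType_eq {v w : List (Fin 2)} (h : switchType v = switchType w) :
    numSwitches v = numSwitches w := by
  unfold switchType at h
  unfold numSwitches
  rw [Prod.mk.injEq] at h
  rw [h.1, h.2]

/-- In a multiset of non-constant paths, the transitions `11` can be gathered in a part `D`. -/
lemma exists_linked_gather {T : ℕ} (hT : 3 ≤ T) (D W : Multiset (List (Fin 2)))
    (hD : ∀ l ∈ D, l.length = T ∧ 1 ≤ numSwitches l)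
    (hW : ∀ l ∈ W, l.length = T ∧ 1 ≤ numSwitches l) :
    ∃ D' W', Linked T (D + W) (D' + W') ∧ D'.map switchType = D.map switchType ∧
      W'.map switchType = W.map switchType ∧
      ((∀ v ∈ D', numTransitions 0 0 v = 0) ∨ ∀ w ∈ W', numTransitions 1 1 w = 0) := by
  -- Each exchange trades a loop 00 of `D` for a loop 11 of `W` and keeps all types, so the loops 00
  -- in `D` decrease.
  induction hn : totalTransitions 0 0 D using Nat.strong_induction_on generalizing D W with
  | _ n ih =>
  by_cases hgath : (∀ v ∈ D, numTransitions 0 0 v = 0) ∨ ∀ w ∈ W, numTransitions 1 1 w = 0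
  · exact ⟨D, W, Linked.refl _, rfl, rfl, hgath⟩
  push Not at hgath
  obtain ⟨⟨v, hv, hv0⟩, w, hw, hw0⟩ := hgath
  obtain ⟨D, rfl⟩ := Multiset.exists_cons_of_mem hv
  obtain ⟨W, rfl⟩ := Multiset.exists_cons_of_mem hw
  obtain ⟨v', w', hl, hsv, hsw, h00⟩ := exists_linked_exchange hT (hD v hv).1 (hW w hw).1
    (hD v hv).2 (hW w hw).2 (by omega) (by omega)
  have hlen : v'.length = T ∧ w'.length = T := by
    have := hl.length_iff.1 (by simp [(hD v hv).1, (hW w hw).1])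
    simpa using this
  have hrest : ∀ l ∈ D + W, l.length = T := by
    intro l hl
    rcases Multiset.mem_add.1 hl with h | h
    · exact (hD l (Multiset.mem_cons_of_mem h)).1
    · exact (hW l (Multiset.mem_cons_of_mem h)).1
  have hstep : Linked T (v ::ₘ D + w ::ₘ W) (v' ::ₘ D + w' ::ₘ W) := by
    have := hl.add_right hrest
    have e : ∀ a b : List (Fin 2), ({a, b} : Multiset _) + (D + W) = a ::ₘ D + b ::ₘ W := by
      intro a b
      rw [Multiset.insert_eq_cons, Multiset.cons_add, Multiset.singleton_add, Multiset.cons_add,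
        Multiset.add_cons]
    rwa [e, e] at this
  obtain ⟨D', W', h₁, h₂, h₃, h₄⟩ := ih (totalTransitions 0 0 (v' ::ₘ D))
    (by rw [← hn]; simp; omega) (v' ::ₘ D) (w' ::ₘ W)
    (by
      intro l hl
      rcases Multiset.mem_cons.1 hl with rfl | h
      · exact ⟨hlen.1, by rw [numSwitches_eq_of_switchType_eq hsv]; exact (hD v hv).2⟩
      · exact hD l (Multiset.mem_cons_of_mem h))
    (by
      intro l hl
      rcases Multiset.mem_cons.1 hl with rfl | h
      · exact ⟨hlen.2, by rw [numSwitches_eq_of_switchType_eq hsw]; exact (hW w hw).2⟩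
      · exact hW l (Multiset.mem_cons_of_mem h)) rfl
  exact ⟨D', W', hstep.trans h₁, by simpa [hsv] using h₂, by simpa [hsw] using h₃, h₄⟩

/-! ### Balanced multisets and their common type. -/

/-- The numbers of switches in the paths of `P` are as close together as moves of degree two can
bring them. -/
def BalancedSwitches (P : Multiset (List (Fin 2))) : Prop :=
  ∀ v ∈ P, ∀ w ∈ P, numSwitches v ≤ numSwitches w + 1 ∨ (numSwitches v = numSwitches w + 2 ∧
    numTransitions 0 1 v + numTransitions 1 0 w = numTransitions 0 1 w + numTransitions 1 0 v ∧
    numTransitions 0 1 v ≠ numTransitions 1 0 v)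

/-- The sum of the squares of the switch counts is a potential: any pair violating balance admits a
step that lowers it. -/
lemma exists_linked_balanced {T : ℕ} (hT : 2 ≤ T) (P : Multiset (List (Fin 2)))
    (hP : ∀ l ∈ P, l.length = T) : ∃ P', Linked T P P' ∧ BalancedSwitches P' := by
  induction hn : (P.map fun l => numSwitches l ^ 2).sum using Nat.strong_induction_on
    generalizing P with
  | _ n ih =>
  by_cases hb : BalancedSwitches P
  · exact ⟨P, Linked.refl _, hb⟩
  unfold BalancedSwitches at hb
  push Not at hb
  obtain ⟨v, hv, w, hw, hlt, hex⟩ := hb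
  have hvw : w ≠ v := by rintro rfl; omega
  obtain ⟨M, rfl⟩ := Multiset.exists_cons_of_mem hv
  obtain ⟨M, rfl⟩ := Multiset.exists_cons_of_mem ((Multiset.mem_cons.1 hw).resolve_left hvw)
  obtain ⟨v', w', hl, hsq⟩ := exists_linked_pair_sq_lt hT (hP v hv) (hP w hw) hlt
    (fun h => h.2.2 (hex h.1 h.2.1))
  have e : ∀ a b : List (Fin 2), ({a, b} : Multiset _) + M = a ::ₘ b ::ₘ M := by
    intro a b
    rw [Multiset.insert_eq_cons, Multiset.cons_add, Multiset.singleton_add]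
  have hstep : Linked T (v ::ₘ w ::ₘ M) (v' ::ₘ w' ::ₘ M) := by
    rw [← e, ← e]
    exact hl.add_right fun l hl =>
      hP l (Multiset.mem_cons_of_mem (Multiset.mem_cons_of_mem hl))
  obtain ⟨P', h₁, h₂⟩ := ih _ (by rw [← hn]; simp; omega) _ (hstep.length_iff.1 hP) rfl
  exact ⟨P', hstep.trans h₁, h₂⟩

/-- If the values of `f` on `P` do not exceed `c`, the values on `Q` are at least `c`, and
the averages agree, then all the values are equal to `c`. -/
lemma forall_eq_of_sum_eq {α : Type} {P Q : Multiset α} {f : α → ℤ} {c : ℤ}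
    (hcard : P.card = Q.card) (hsum : (P.map f).sum = (Q.map f).sum)
    (hP : ∀ v ∈ P, f v ≤ c) (hQ : ∀ w ∈ Q, c ≤ f w) :
    (∀ v ∈ P, f v = c) ∧ ∀ w ∈ Q, f w = c := by
  have upper : ∀ M : Multiset α, (∀ v ∈ M, f v ≤ c) → (M.map f).sum ≤ M.card * c := by
    intro M hM
    have := Multiset.sum_le_card_nsmul (M.map f) c (by simpa using hM)
    simpa using this
  have lower : ∀ M : Multiset α, (∀ v ∈ M, c ≤ f v) → M.card * c ≤ (M.map f).sum := by
    intro M hM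
    have := Multiset.card_nsmul_le_sum (s := M.map f) (a := c) (by simpa using hM)
    simpa using this
  constructor
  · intro v hv
    obtain ⟨M, rfl⟩ := Multiset.exists_cons_of_mem hv
    have h₁ := upper M fun u hu => hP u (Multiset.mem_cons_of_mem hu)
    have h₂ := lower Q hQ
    have h₃ := hP v hv
    rw [← hcard, ← hsum] at h₂
    simp only [Multiset.card_cons, Multiset.map_cons, Multiset.sum_cons] at h₂
    push_cast at h₂
    linarith
  · intro w hw
    obtain ⟨M, rfl⟩ := Multiset.exists_cons_of_mem hw
    have h₁ := lower M fun u hu => hQ u (Multiset.mem_cons_of_mem hu)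
    have h₂ := upper P hP
    have h₃ := hQ w hw
    rw [hcard, hsum] at h₂
    simp only [Multiset.card_cons, Multiset.map_cons, Multiset.sum_cons] at h₂
    push_cast at h₂
    linarith

lemma sum_map_numSwitches (P : Multiset (List (Fin 2))) :
    (P.map fun l => (numSwitches l : ℤ)).sum =
      totalTransitions 0 1 P + totalTransitions 1 0 P := by
  induction P using Multiset.induction with
  | empty => simp
  | cons a P ih =>
    rw [Multiset.map_cons, Multiset.sum_cons, ih, totalTransitions_cons, totalTransitions_cons,
      numSwitches]
    push_cast
    ring

/-- The excess of the switches from `0` to `1` over those from `1` to `0`. -/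
def switchExcess (l : List (Fin 2)) : ℤ := numTransitions 0 1 l - numTransitions 1 0 l

lemma sum_map_switchExcess (P : Multiset (List (Fin 2))) :
    (P.map switchExcess).sum = totalTransitions 0 1 P - totalTransitions 1 0 P := by
  induction P using Multiset.induction with
  | empty => simp
  | cons a P ih => simp [ih, switchExcess]; ring

lemma switchExcess_cases (l : List (Fin 2)) :
    switchExcess l = 0 ∧ numSwitches l % 2 = 0 ∨ switchExcess l = 1 ∧ numSwitches l % 2 = 1 ∨
      switchExcess l = -1 ∧ numSwitches l % 2 = 1 := by
  have := numTransitions_switch_le l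
  unfold switchExcess numSwitches
  omega

lemma switchType_eq_iff {v w : List (Fin 2)} :
    switchType v = switchType w ↔
      numSwitches v = numSwitches w ∧ switchExcess v = switchExcess w := by
  unfold switchType numSwitches switchExcess
  rw [Prod.mk.injEq]
  omega

lemma BalancedSwitches.le {P : Multiset (List (Fin 2))} (hP : BalancedSwitches P) {v w : List (Fin 2)}
    (hv : v ∈ P) (hw : w ∈ P) : numSwitches v ≤ numSwitches w + 1 ∨
      (numSwitches v = numSwitches w + 2 ∧ switchExcess v = switchExcess w ∧
        switchExcess v ≠ 0) := by
  have := hP v hv w hw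
  unfold switchExcess
  omega

/-- BalancedSwitches multisets of the same size with the same numbers of switches have a common type of
path. -/
lemma exists_switchType_eq {P Q : Multiset (List (Fin 2))} (hP : BalancedSwitches P) (hQ : BalancedSwitches Q)
    (hcard : P.card = Q.card) (hpos : 0 < P.card)
    (h01 : totalTransitions 0 1 P = totalTransitions 0 1 Q)
    (h10 : totalTransitions 1 0 P = totalTransitions 1 0 Q) :
    ∃ v ∈ P, ∃ w ∈ Q, switchType v = switchType w := by
  have avg : ∀ {P Q : Multiset (List (Fin 2))} (c : ℕ), P.card = Q.card →
      totalTransitions 0 1 P = totalTransitions 0 1 Q →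
      totalTransitions 1 0 P = totalTransitions 1 0 Q → (∀ v ∈ P, numSwitches v ≤ c) →
      (∀ w ∈ Q, c ≤ numSwitches w) →
      (∀ v ∈ P, numSwitches v = c) ∧ ∀ w ∈ Q, numSwitches w = c := by
    intro P Q c hcard h01 h10 hP hQ
    have := forall_eq_of_sum_eq (c := c) hcard
      (by rw [sum_map_numSwitches, sum_map_numSwitches, h01, h10])
      (fun v hv => by exact_mod_cast hP v hv) (fun w hw => by exact_mod_cast hQ w hw)
    exact_mod_cast this
  have exc : ∀ {P Q : Multiset (List (Fin 2))}, P.card = Q.card →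
      totalTransitions 0 1 P = totalTransitions 0 1 Q →
      totalTransitions 1 0 P = totalTransitions 1 0 Q → ∀ c : ℤ, c = 1 ∨ c = -1 →
      (∀ w ∈ Q, switchExcess w = c) → ∀ v ∈ P, switchExcess v = c := by
    intro P Q hcard h01 h10 c hc hQ
    have hs : (P.map switchExcess).sum = (Q.map switchExcess).sum := by
      rw [sum_map_switchExcess, sum_map_switchExcess, h01, h10]
    rcases hc with rfl | rfl
    · exact (forall_eq_of_sum_eq hcard hs
        (fun v _ => by rcases switchExcess_cases v with h | h | h <;> omega)
        fun w hw => (hQ w hw).ge).1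
    · exact (forall_eq_of_sum_eq hcard.symm hs.symm (fun w hw => (hQ w hw).le)
        fun v _ => by rcases switchExcess_cases v with h | h | h <;> omega).2
  -- Paths of opposite excess never form an exceptional pair, so their counts differ by at most one
  -- and, being odd, agree. Every `u` has excess opposite to that of `v` or of `w`.
  have const : ∀ {P : Multiset (List (Fin 2))}, BalancedSwitches P → ∀ v ∈ P, switchExcess v = 1 →
      ∀ w ∈ P, switchExcess w = -1 → (∀ u ∈ P, switchExcess u ≠ 0) →
      ∀ u ∈ P, numSwitches u = numSwitches v := by
    intro P hP v hv hv1 w hw hw1 h0 u hu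
    have := hP.le hu hw
    have := hP.le hw hu
    have := hP.le hv hw
    have := hP.le hw hv
    have := hP.le hu hv
    have := hP.le hv hu
    have := h0 u hu
    rcases switchExcess_cases v with h | h | h <;> rcases switchExcess_cases w with h' | h' | h' <;>
      rcases switchExcess_cases u with h'' | h'' | h'' <;> omega
  have pm : ∀ {P : Multiset (List (Fin 2))}, (∀ u ∈ P, switchExcess u ≠ 0) →
      ¬ (∀ u ∈ P, switchExcess u = 1) → ¬ (∀ u ∈ P, switchExcess u = -1) →
      (∃ v ∈ P, switchExcess v = 1) ∧ ∃ w ∈ P, switchExcess w = -1 := by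
    intro P h0 h₁ h₂
    push Not at h₁ h₂
    obtain ⟨a, ha, ha'⟩ := h₁
    obtain ⟨b, hb, hb'⟩ := h₂
    have := h0 a ha
    have := h0 b hb
    exact ⟨⟨b, hb, by rcases switchExcess_cases b with h | h | h <;> omega⟩,
      ⟨a, ha, by rcases switchExcess_cases a with h | h | h <;> omega⟩⟩
  -- Both signs must occur in `Q`, since constant extremal excess would spread to `P`. So all counts
  -- in `Q` equal one odd number. As `v` has an even count and cannot be in an exceptional pair, no
  -- count in `P` lies strictly beyond that number, on the side opposite to `v`; this contradicts
  -- the averages.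
  have mixed : ∀ {P Q : Multiset (List (Fin 2))}, BalancedSwitches P → BalancedSwitches Q → P.card = Q.card →
      totalTransitions 0 1 P = totalTransitions 0 1 Q →
      totalTransitions 1 0 P = totalTransitions 1 0 Q → ∀ v ∈ P, switchExcess v = 0 →
      (∀ w ∈ Q, switchExcess w ≠ 0) → False := by
    intro P Q hP hQ hcard h01 h10 v hv hv0 hQ0
    obtain ⟨⟨a, ha, ha1⟩, b, hb, hb1⟩ := pm hQ0
      (fun h => by have := exc hcard h01 h10 1 (Or.inl rfl) h v hv; omega)
      (fun h => by have := exc hcard h01 h10 (-1) (Or.inr rfl) h v hv; omega)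
    have hc := const hQ a ha ha1 b hb hb1 hQ0
    have hpar : numSwitches v ≠ numSwitches a := by
      rcases switchExcess_cases a with h | h | h <;>
        rcases switchExcess_cases v with h' | h' | h' <;> omega
    rcases lt_or_gt_of_ne hpar with hlt | hlt
    · exact hpar ((avg (numSwitches a) hcard h01 h10
        (fun u hu => by have := hP.le hu hv; omega) fun w hw => (hc w hw).ge).1 v hv)
    · exact hpar ((avg (numSwitches a) hcard.symm h01.symm h10.symm (fun w hw => (hc w hw).le)
        fun u hu => by have := hP.le hv hu; omega).2 v hv)
  -- Counts in `P` are at most that of `v` plus one, counts in `Q` at least that of `w` minus one; a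
  -- gap of two would force all of them to be equal, `v` included.
  have zero : ∀ {P Q : Multiset (List (Fin 2))}, BalancedSwitches P → BalancedSwitches Q → P.card = Q.card →
      totalTransitions 0 1 P = totalTransitions 0 1 Q →
      totalTransitions 1 0 P = totalTransitions 1 0 Q → ∀ v ∈ P, switchExcess v = 0 →
      ∀ w ∈ Q, switchExcess w = 0 → numSwitches w ≤ numSwitches v := by
    intro P Q hP hQ hcard h01 h10 v hv hv0 w hw hw0
    by_contra hlt
    have hpar : numSwitches v + 2 ≤ numSwitches w := by
      rcases switchExcess_cases w with h | h | h <;>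
        rcases switchExcess_cases v with h' | h' | h' <;> omega
    have := (avg (numSwitches v + 1) hcard h01 h10
      (fun u hu => by have := hP.le hu hv; omega)
      fun u hu => by have := hQ.le hw hu; omega).1 v hv
    omega
  -- All counts are odd and those in `Q` lie within two of each other, so a larger maximum in `Q`
  -- would put every count of `Q` at or above the maximum of `P`, against the averages.
  have same : ∀ {P Q : Multiset (List (Fin 2))}, BalancedSwitches Q → P.card = Q.card →
      totalTransitions 0 1 P = totalTransitions 0 1 Q →
      totalTransitions 1 0 P = totalTransitions 1 0 Q → ∀ c : ℤ, c = 1 ∨ c = -1 →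
      (∀ v ∈ P, switchExcess v = c) → (∀ w ∈ Q, switchExcess w = c) →
      ∀ v ∈ P, (∀ u ∈ P, numSwitches u ≤ numSwitches v) → ∀ w ∈ Q,
      numSwitches w ≤ numSwitches v := by
    intro P Q hQ hcard h01 h10 c hc hPc hQc v hv hmax w hw
    by_contra hlt
    have hpar : numSwitches v + 2 ≤ numSwitches w := by
      have := hPc v hv
      have := hQc w hw
      rcases switchExcess_cases w with h | h | h <;>
        rcases switchExcess_cases v with h' | h' | h' <;> omega
    have := (avg (numSwitches v) hcard h01 h10 hmax
      fun u hu => by have := hQ.le hw hu; omega).2 w hw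
    omega
  have max : ∀ {P : Multiset (List (Fin 2))}, 0 < P.card →
      ∃ v ∈ P, ∀ u ∈ P, numSwitches u ≤ numSwitches v := by
    intro P hpos
    obtain ⟨a, ha⟩ := Multiset.card_pos_iff_exists_mem.1 hpos
    obtain ⟨v, hv, hmax⟩ := P.toFinset.exists_max_image numSwitches ⟨a, by simpa using ha⟩
    exact ⟨v, by simpa using hv, fun u hu => hmax u (by simpa using hu)⟩
  by_cases hP0 : ∃ v ∈ P, switchExcess v = 0
  · obtain ⟨v, hv, hv0⟩ := hP0
    by_cases hQ0 : ∃ w ∈ Q, switchExcess w = 0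
    · obtain ⟨w, hw, hw0⟩ := hQ0
      exact ⟨v, hv, w, hw, switchType_eq_iff.2
        ⟨le_antisymm (zero hQ hP hcard.symm h01.symm h10.symm w hw hw0 v hv hv0)
          (zero hP hQ hcard h01 h10 v hv hv0 w hw hw0), hv0.trans hw0.symm⟩⟩
    · push Not at hQ0
      exact (mixed hP hQ hcard h01 h10 v hv hv0 hQ0).elim
  push Not at hP0
  have hQ0 : ∀ w ∈ Q, switchExcess w ≠ 0 := fun w hw hw0 =>
    mixed hQ hP hcard.symm h01.symm h10.symm w hw hw0 hP0
  by_cases hs : ∃ c : ℤ, (c = 1 ∨ c = -1) ∧ ∀ w ∈ Q, switchExcess w = c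
  · obtain ⟨c, hc, hQc⟩ := hs
    have hPc := exc hcard h01 h10 c hc hQc
    obtain ⟨v, hv, hvmax⟩ := max hpos
    obtain ⟨w, hw, hwmax⟩ := max (hcard ▸ hpos)
    exact ⟨v, hv, w, hw, switchType_eq_iff.2
      ⟨le_antisymm (same hP hcard.symm h01.symm h10.symm c hc hQc hPc w hw hwmax v hv)
        (same hQ hcard h01 h10 c hc hPc hQc v hv hvmax w hw), (hPc v hv).trans (hQc w hw).symm⟩⟩
  · have hq : ∀ c : ℤ, (c = 1 ∨ c = -1) → ¬ ∀ w ∈ Q, switchExcess w = c :=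
      fun c hc h => hs ⟨c, hc, h⟩
    have hp : ∀ c : ℤ, (c = 1 ∨ c = -1) → ¬ ∀ v ∈ P, switchExcess v = c :=
      fun c hc h => hq c hc (exc hcard.symm h01.symm h10.symm c hc h)
    obtain ⟨⟨v, hv, hv1⟩, v', hv', hv1'⟩ := pm hP0 (hp 1 (Or.inl rfl)) (hp _ (Or.inr rfl))
    obtain ⟨⟨w, hw, hw1⟩, w', hw', hw1'⟩ := pm hQ0 (hq 1 (Or.inl rfl)) (hq _ (Or.inr rfl))
    have hcP := const hP v hv hv1 v' hv' hv1' hP0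
    have hcQ := const hQ w hw hw1 w' hw' hw1' hQ0
    refine ⟨v, hv, w, hw, switchType_eq_iff.2 ⟨?_, hv1.trans hw1.symm⟩⟩
    rcases le_total (numSwitches v) (numSwitches w) with hle | hle
    · exact ((avg (numSwitches v) hcard h01 h10 (fun u hu => (hcP u hu).le)
        fun u hu => (hcQ u hu).symm ▸ hle).2 w hw).symm
    · exact (avg (numSwitches w) hcard.symm h01.symm h10.symm (fun u hu => (hcQ u hu).le)
        fun u hu => (hcP u hu).symm ▸ hle).2 v hv

/-! ### Turning a constant path `0^T` into `1^T`. -/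

/-- A constant path `0^T` and two paths with one switch each and enough transitions `11` are linked
to a multiset that contains `1^T`. -/
lemma exists_linked_replicate_one {T : ℕ} (hT : 2 ≤ T) {v w : List (Fin 2)}
    (hv : v.length = T) (hw : w.length = T) (hv1 : numSwitches v = 1) (hw1 : numSwitches w = 1)
    (h : T - 1 ≤ numTransitions 1 1 v + numTransitions 1 1 w) :
    ∃ M, Linked T {List.replicate T 0, v, w} M ∧ List.replicate T 1 ∈ M := by
  have main : ∀ v w : List (Fin 2), v.length = T → w.length = T →
      T - 1 ≤ numTransitions 1 1 v + numTransitions 1 1 w →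
      (numTransitions 0 1 v = 1 ∧ numTransitions 1 0 v = 0 ∧
        numTransitions 0 1 w = 1 ∧ numTransitions 1 0 w = 0 ∧
          numTransitions 0 0 v ≤ numTransitions 0 0 w) ∨
      (numTransitions 0 1 v = 0 ∧ numTransitions 1 0 v = 1 ∧
        numTransitions 0 1 w = 0 ∧ numTransitions 1 0 w = 1 ∧
          numTransitions 0 0 v ≤ numTransitions 0 0 w) ∨
      (numTransitions 0 1 v = 1 ∧ numTransitions 1 0 v = 0 ∧
        numTransitions 0 1 w = 0 ∧ numTransitions 1 0 w = 1) →
      ∃ M, Linked T {List.replicate T 0, v, w} M ∧ List.replicate T 1 ∈ M := by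
    intro v w hv hw h hc
    have slide : ∀ (A B : ℕ), A ≤ B → A + B + 2 ≤ T - 1 → ∃ W : Multiset (List (Fin 2)),
        SlidingSwap T 0 1 {List.replicate T 0, stepPath T 0 1 (A + 1), stepPath T 0 1 (B + 1)} W ∧
        SlidingSwap T 0 1 {List.replicate T 0, (stepPath T 0 1 (A + 1)).reverse,
          (stepPath T 0 1 (B + 1)).reverse} (W.map List.reverse) ∧ List.replicate T 1 ∈ W ∧
        ∀ l ∈ W, l.length = T := by
      intro A B hAB hABT
      -- Only `1^T` matters afterwards, so the least admissible value `u = b` is taken.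
      refine ⟨{List.replicate T 1, stepPath T 0 1 (A + 1 + (B + 1)),
        stepPath T 0 1 (B + 1 + (T - 1 - (B + 1)))},
        ⟨A + 1, B + 1, B + 1, by omega, by omega, by omega, le_rfl, by omega, _, _, rfl, rfl,
          Or.inl ⟨rfl, rfl⟩⟩,
        ⟨A + 1, B + 1, B + 1, by omega, by omega, by omega, le_rfl, by omega, _, _, rfl, rfl,
          Or.inr ⟨by simp, rfl⟩⟩, by simp, ?_⟩
      simp [stepPath]
      omega
    have first : ∀ {v' w' : List (Fin 2)}, Linked T {v} {v'} → Linked T {w} {w'} →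
        Linked T {List.replicate T 0, v, w} {List.replicate T 0, v', w'} := fun h₁ h₂ =>
      (h₁.pair h₂ hv hw).cons (by simp)
    rcases hc with ⟨h₁, h₂, h₃, h₄, hle⟩ | ⟨h₁, h₂, h₃, h₄, hle⟩ | ⟨h₁, h₂, h₃, h₄⟩
    · obtain ⟨l₁, e₁⟩ := linked_step hT (i := 0) (j := 1) (by simp) hv h₁ h₂
      obtain ⟨l₂, e₂⟩ := linked_step hT (i := 0) (j := 1) (by simp) hw h₃ h₄
      obtain ⟨W, hW, -, hmem, hlen⟩ := slide _ _ hle (by omega)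
      refine ⟨W, (first l₁ l₂).trans ?_, hmem⟩
      have hW' := Linked.of_basicSwap
        (Or.inr (Or.inr (Or.inr (Or.inr (Or.inr hW))))) (by simp [stepPath]; omega) hlen
      unfold stepPath at hW'
      rwa [show T - (numTransitions 0 0 v + 1) = numTransitions 1 1 v + 1 by omega,
        show T - (numTransitions 0 0 w + 1) = numTransitions 1 1 w + 1 by omega] at hW'
    · obtain ⟨l₁, e₁⟩ := linked_step hT (i := 1) (j := 0) (by simp) hv h₂ h₁
      obtain ⟨l₂, e₂⟩ := linked_step hT (i := 1) (j := 0) (by simp) hw h₄ h₃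
      obtain ⟨W, -, hW, hmem, hlen⟩ := slide _ _ hle (by omega)
      refine ⟨W.map List.reverse, (first l₁ l₂).trans ?_, Multiset.mem_map.2 ⟨_, hmem, by simp⟩⟩
      have hW' := Linked.of_basicSwap
        (Or.inr (Or.inr (Or.inr (Or.inr (Or.inr hW))))) (by simp [stepPath]; omega)
          (by simpa using hlen)
      unfold stepPath at hW'
      rw [List.reverse_append, List.reverse_append] at hW'
      simp only [List.reverse_replicate] at hW'
      rwa [show T - (numTransitions 0 0 v + 1) = numTransitions 1 1 v + 1 by omega,
        show T - (numTransitions 0 0 w + 1) = numTransitions 1 1 w + 1 by omega] at hW'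
    -- For opposite steps the bound on the loops 11 keeps `w` in state 1 until `v` arrives there; a
    -- single crossing at that time yields `1^T`, and `0^T` stays idle.
    · obtain ⟨l₁, e₁⟩ := linked_step hT (i := 0) (j := 1) (by simp) hv h₁ h₂
      obtain ⟨l₂, e₂⟩ := linked_step hT (i := 1) (j := 0) (by simp) hw h₄ h₃
      refine ⟨List.replicate T 0 ::ₘ
          {List.replicate (numTransitions 0 0 v + 1) 0 ++ 1 ::
            (List.replicate (numTransitions 1 1 w - numTransitions 0 0 v - 1) 1 ++
              List.replicate (numTransitions 0 0 w + 1) 0),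
          List.replicate (numTransitions 0 0 v + 1) 1 ++ 1 ::
            List.replicate (numTransitions 1 1 v) 1},
        (first l₁ l₂).trans (Linked.cons ?_ (by simp)), ?_⟩
      · have e : List.replicate (numTransitions 1 1 w + 1) (1 : Fin 2) ++
            List.replicate (numTransitions 0 0 w + 1) 0 =
            List.replicate (numTransitions 0 0 v + 1) 1 ++ 1 ::
            (List.replicate (numTransitions 1 1 w - numTransitions 0 0 v - 1) 1 ++
              List.replicate (numTransitions 0 0 w + 1) 0) := by
          rw [← List.cons_append, ← List.replicate_succ, ← List.append_assoc,
            List.replicate_append_replicate]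
          congr 2
          omega
        rw [e, List.replicate_succ (n := numTransitions 1 1 v)]
        exact Linked.crossing 1 (by simp) (by simp; omega) (by simp; omega)
      · rw [← List.replicate_succ, List.replicate_append_replicate,
          show numTransitions 0 0 v + 1 + (numTransitions 1 1 v + 1) = T by omega]
        simp
  unfold numSwitches at hv1 hw1
  by_cases hvw : (numTransitions 0 1 v = numTransitions 0 1 w ∧
      numTransitions 0 0 v ≤ numTransitions 0 0 w) ∨
      (numTransitions 0 1 v = 1 ∧ numTransitions 0 1 w = 0)
  · exact main v w hv hw h (by omega)
  · obtain ⟨M, hM⟩ := main w v hw hv (by omega) (by omega)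
    rw [Multiset.pair_comm] at hM
    exact ⟨M, hM⟩

/-- If `1^T` is absent, all loops 11 lie in paths with one switch, each holding at most `T - 2`. So
there are at least two such paths, and enough loops can be gathered in two of them. -/
lemma exists_linked_replicate_one_mem {T : ℕ} (hT : 3 ≤ T) {P : Multiset (List (Fin 2))}
    (hP : ∀ l ∈ P, l.length = T) (hsw : ∀ l ∈ P, numSwitches l ≤ 1)
    (h0 : List.replicate T 0 ∈ P) (h : T - 1 ≤ totalTransitions 1 1 P) :
    ∃ P', Linked T P P' ∧ List.replicate T 1 ∈ P' := by
  by_cases h1 : List.replicate T 1 ∈ P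
  · exact ⟨P, Linked.refl _, h1⟩
  set V := P.filter fun l => numSwitches l = 1 with hV
  set Z := P.filter fun l => ¬ numSwitches l = 1 with hZ
  have hVZ : V + Z = P := Multiset.filter_add_not _ P
  have hswz : numSwitches (List.replicate T (0 : Fin 2)) = 0 := by
    simp [numSwitches, numTransitions_replicate]
  have h0Z : List.replicate T 0 ∈ Z := Multiset.mem_filter.2 ⟨h0, by simp [hswz]⟩
  have hVl : ∀ l ∈ V, l.length = T ∧ numSwitches l = 1 := fun l hl =>
    ⟨hP l (Multiset.mem_filter.1 hl).1, (Multiset.mem_filter.1 hl).2⟩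
  have hZ0 : totalTransitions 1 1 Z = 0 := by
    unfold totalTransitions
    rw [Multiset.sum_eq_zero_iff]
    intro n hn
    obtain ⟨l, hl, rfl⟩ := Multiset.mem_map.1 hn
    obtain ⟨hlP, hl1⟩ := Multiset.mem_filter.1 hl
    have hlen := hP l hlP
    have hsw0 : numSwitches l = 0 := by have := hsw l hlP; omega
    cases l with
    | nil => rfl
    | cons x l =>
      have e := eq_replicate_of_numSwitches_eq_zero hsw0
      rw [show l.length + 1 = T by simpa using hlen] at e
      rw [e] at hlP ⊢
      have hx : x ≠ 1 := fun hx => h1 (hx ▸ hlP)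
      rw [numTransitions_replicate, if_neg (fun h => hx h.1)]
  have htot : T - 1 ≤ totalTransitions 1 1 V := by
    rw [← hVZ, totalTransitions_add, hZ0] at h
    exact h
  have hle : ∀ l : List (Fin 2), l.length = T → numSwitches l = 1 →
      numTransitions 0 0 l + numTransitions 1 1 l + 2 = T := by
    intro l hl h1
    have := sum_numTransitions l
    unfold numSwitches at h1
    omega
  obtain ⟨a, b, W, hab⟩ : ∃ a b W, V = a ::ₘ b ::ₘ W := by
    rcases V.empty_or_exists_mem with h | ⟨a, ha⟩
    · rw [h] at htot; simp at htot; omega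
    obtain ⟨W, hW⟩ := Multiset.exists_cons_of_mem ha
    rcases W.empty_or_exists_mem with h | ⟨b, hb⟩
    · rw [hW, h] at htot
      have := hle a (hVl a ha).1 (hVl a ha).2
      simp at htot
      omega
    obtain ⟨W', hW'⟩ := Multiset.exists_cons_of_mem hb
    exact ⟨a, b, W', by rw [hW, hW']⟩
  obtain ⟨Z', hZ'⟩ := Multiset.exists_cons_of_mem h0Z
  have hsum : ({a, b} : Multiset _) + W = V := by
    rw [hab, Multiset.insert_eq_cons, Multiset.cons_add, Multiset.singleton_add]
  have hsub : ∀ l ∈ ({a, b} : Multiset _) + W, l.length = T ∧ 1 ≤ numSwitches l := by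
    intro l hl
    rw [hsum] at hl
    exact ⟨(hVl l hl).1, (hVl l hl).2.ge⟩
  obtain ⟨D', W', hl, hD', hW', hgath⟩ := exists_linked_gather hT {a, b} W
    (fun l hl => hsub l (Multiset.mem_add.2 (Or.inl hl)))
    (fun l hl => hsub l (Multiset.mem_add.2 (Or.inr hl)))
  obtain ⟨v, w, rfl⟩ : ∃ v w, D' = {v, w} := by
    have : D'.card = 2 := by
      have := congrArg Multiset.card hD'
      simpa using this
    exact Multiset.card_eq_two.1 this
  have hlen := hl.length_iff.1 fun l hl => (hsub l hl).1
  have hsw1 : ∀ l ∈ ({v, w} : Multiset _), l.length = T ∧ numSwitches l = 1 := by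
    intro l hl
    obtain ⟨u, hu, hul⟩ := exists_mem_switchType_eq hD' hl
    refine ⟨hlen l (Multiset.mem_add.2 (Or.inl hl)), ?_⟩
    rw [← numSwitches_eq_of_switchType_eq hul]
    exact (hVl u (hsum ▸ Multiset.mem_add.2 (Or.inl hu))).2
  have hv := hsw1 v (by simp)
  have hw := hsw1 w (by simp)
  -- Either both paths are full, with `2 * (T - 2) ≥ T - 1` loops 11 because `T ≥ 3`, or they hold
  -- all the loops 11 of the one-switch paths.
  have hge : T - 1 ≤ numTransitions 1 1 v + numTransitions 1 1 w := by
    rcases hgath with hs | hs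
    · have := hs v (by simp)
      have := hs w (by simp)
      have := hle v hv.1 hv.2
      have := hle w hw.1 hw.2
      omega
    · have hW0 : totalTransitions 1 1 W' = 0 := by
        unfold totalTransitions
        rw [Multiset.sum_eq_zero_iff]
        simpa using hs
      have := hl.totalTransitions_eq 1 1
      rw [hsum, totalTransitions_add, hW0] at this
      simp at this
      omega
  obtain ⟨M, hM, hmem⟩ := exists_linked_replicate_one (by omega) hv.1 hw.1 hv.2 hw.2 hge
  have hZl : ∀ l ∈ Z, l.length = T := fun l hl => hP l (Multiset.mem_filter.1 hl).1
  have hZl' : ∀ l ∈ W' + Z', l.length = T := by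
    intro l hl
    rcases Multiset.mem_add.1 hl with h | h
    · exact hlen l (Multiset.mem_add.2 (Or.inr h))
    · exact hZl l (hZ' ▸ Multiset.mem_cons_of_mem h)
  refine ⟨M + (W' + Z'), ?_, Multiset.mem_add.2 (Or.inl hmem)⟩
  have h₁ := hl.add_right hZl
  rw [hsum, hVZ] at h₁
  refine h₁.trans ?_
  have h₂ := hM.add_right hZl'
  convert h₂ using 1
  rw [hZ']
  simp only [Multiset.insert_eq_cons, ← Multiset.singleton_add]
  abel

/-! ### Producing a common path; induction on the number of paths. -/

lemma exists_linked_mem_of_forall_pos {T : ℕ} (hT : 3 ≤ T) {P Q : Multiset (List (Fin 2))}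
    (hP : ∀ l ∈ P, l.length = T ∧ 1 ≤ numSwitches l)
    (hQ : ∀ l ∈ Q, l.length = T ∧ 1 ≤ numSwitches l)
    (htot : totalTransitions 1 1 P = totalTransitions 1 1 Q)
    (hshare : ∃ v ∈ P, ∃ w ∈ Q, switchType v = switchType w) :
    ∃ P' Q' l, Linked T P P' ∧ Linked T Q Q' ∧ l ∈ P' ∧ l ∈ Q' := by
  have gather : ∀ {P : Multiset (List (Fin 2))}, (∀ l ∈ P, l.length = T ∧ 1 ≤ numSwitches l) →
      ∀ v ∈ P, ∃ v' W', Linked T P (v' ::ₘ W') ∧ switchType v' = switchType v ∧ v'.length = T ∧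
        numTransitions 1 1 v' ≤ totalTransitions 1 1 P ∧
        (numTransitions 0 0 v' = 0 ∨ numTransitions 1 1 v' = totalTransitions 1 1 P) := by
    intro P hP v hv
    obtain ⟨W, rfl⟩ := Multiset.exists_cons_of_mem hv
    obtain ⟨D', W', hl, hD', -, hgath⟩ := exists_linked_gather hT {v} W
      (by simpa using hP v hv) (fun l hl => hP l (Multiset.mem_cons_of_mem hl))
    rw [Multiset.map_singleton, Multiset.map_eq_singleton] at hD'
    obtain ⟨v', rfl, hv'⟩ := hD'
    rw [Multiset.singleton_add, Multiset.singleton_add] at hl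
    have ht := hl.totalTransitions_eq 1 1
    rw [totalTransitions_cons _ _ v'] at ht
    refine ⟨v', W', hl, hv', hl.length_iff.1 (fun l hl => (hP l hl).1) v' (by simp), by omega, ?_⟩
    refine hgath.imp (fun h => by simpa using h) fun h => ?_
    have hW0 : totalTransitions 1 1 W' = 0 := by
      unfold totalTransitions
      rw [Multiset.sum_eq_zero_iff]
      simpa using h
    omega
  obtain ⟨v, hv, w, hw, hvw⟩ := hshare
  obtain ⟨v', V', hl, hs, hlen, hle, hor⟩ := gather hP v hv
  obtain ⟨w', W', hl', hs', hlen', hle', hor'⟩ := gather hQ w hw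
  have hst : switchType v' = switchType w' := by rw [hs, hs', hvw]
  have h₁ := sum_numTransitions v'
  have h₂ := sum_numTransitions w'
  unfold switchType at hst
  rw [Prod.mk.injEq] at hst
  -- On either side the number of loops 11 is the smaller of the capacity, fixed by length and type,
  -- and the total, and these agree for `P` and `Q`.
  have hsame : SameTransitions w' v' := sameTransitions_of_three (hlen'.trans hlen.symm)
    (by omega) hst.1.symm hst.2.symm
  refine ⟨v' ::ₘ V', v' ::ₘ W', v', hl, hl'.trans ?_, by simp, by simp⟩
  have := (linked_of_sameTransitions (by omega) hlen' hlen hsame).add_right (M := W')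
    fun l hl => hl'.length_iff.1 (fun l hl => (hQ l hl).1) l (Multiset.mem_cons_of_mem hl)
  rwa [Multiset.singleton_add, Multiset.singleton_add] at this

/-- Constant paths are treated apart, as loops are traded only between non-constant ones. In a
balanced multiset a constant path bounds all switch counts by one, so the average is below one and
the other multiset has a constant path as well. -/
lemma exists_linked_mem_of_balanced {T : ℕ} (hT : 3 ≤ T) {P Q : Multiset (List (Fin 2))}
    (hP : ∀ l ∈ P, l.length = T) (hQ : ∀ l ∈ Q, l.length = T) (hbP : BalancedSwitches P)
    (hbQ : BalancedSwitches Q) (hcard : P.card = Q.card) (hpos : 0 < P.card)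
    (htot : ∀ i j, totalTransitions i j P = totalTransitions i j Q) :
    ∃ P' Q' l, Linked T P P' ∧ Linked T Q Q' ∧ l ∈ P' ∧ l ∈ Q' := by
  have le_one : ∀ {P : Multiset (List (Fin 2))}, BalancedSwitches P → ∀ v ∈ P, numSwitches v = 0 →
      ∀ u ∈ P, numSwitches u ≤ 1 := by
    intro P hP v hv hv0 u hu
    have := hP.le hu hv
    rcases switchExcess_cases v with h | h | h <;> omega
  have zero : ∀ {P Q : Multiset (List (Fin 2))}, BalancedSwitches P → P.card = Q.card →
      (∀ i j, totalTransitions i j P = totalTransitions i j Q) → ∀ v ∈ P, numSwitches v = 0 →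
      ∃ w ∈ Q, numSwitches w = 0 := by
    intro P Q hP hcard htot v hv hv0
    by_contra! hQ
    have := (forall_eq_of_sum_eq (P := P) (Q := Q) (f := fun l => (numSwitches l : ℤ)) (c := 1)
      hcard (by rw [sum_map_numSwitches, sum_map_numSwitches, htot, htot])
      (fun u hu => by have := le_one hP v hv hv0 u hu; exact_mod_cast this)
      (fun u hu => by have := hQ u hu; exact_mod_cast Nat.pos_of_ne_zero this)).1 v hv
    simp [hv0] at this
  have repl : ∀ v : List (Fin 2), v.length = T → numSwitches v = 0 →
      v = List.replicate T 0 ∨ v = List.replicate T 1 := by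
    intro v hv hv0
    cases v with
    | nil => simp at hv; omega
    | cons x v =>
      have e := eq_replicate_of_numSwitches_eq_zero hv0
      rw [show v.length + 1 = T by simpa using hv] at e
      rw [e]
      fin_cases x
      · exact Or.inl rfl
      · exact Or.inr rfl
  have slide : ∀ {P Q : Multiset (List (Fin 2))}, (∀ l ∈ P, l.length = T) → BalancedSwitches P →
      totalTransitions 1 1 P = totalTransitions 1 1 Q → List.replicate T 0 ∈ P →
      List.replicate T 1 ∈ Q → ∃ P', Linked T P P' ∧ List.replicate T 1 ∈ P' := by
    intro P Q hP hb ht h0 h1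
    refine exists_linked_replicate_one_mem hT hP
      (le_one hb _ h0 (by simp [numSwitches, numTransitions_replicate])) h0 ?_
    obtain ⟨M, rfl⟩ := Multiset.exists_cons_of_mem h1
    rw [ht, totalTransitions_cons, numTransitions_replicate]
    simp
  by_cases h0 : ∃ v ∈ P, numSwitches v = 0
  · obtain ⟨v, hv, hv0⟩ := h0
    obtain ⟨w, hw, hw0⟩ := zero hbP hcard htot v hv hv0
    rcases repl v (hP v hv) hv0 with rfl | rfl <;> rcases repl w (hQ w hw) hw0 with rfl | rfl
    · exact ⟨P, Q, _, Linked.refl _, Linked.refl _, hv, hw⟩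
    · obtain ⟨P', hl, hm⟩ := slide hP hbP (htot 1 1) hv hw
      exact ⟨P', Q, _, hl, Linked.refl _, hm, hw⟩
    · obtain ⟨Q', hl, hm⟩ := slide hQ hbQ (htot 1 1).symm hw hv
      exact ⟨P, Q', _, Linked.refl _, hl, hv, hm⟩
    · exact ⟨P, Q, _, Linked.refl _, Linked.refl _, hv, hw⟩
  · have h0' : ¬ ∃ w ∈ Q, numSwitches w = 0 := fun ⟨w, hw, hw0⟩ =>
      h0 (zero hbQ hcard.symm (fun i j => (htot i j).symm) w hw hw0)
    push Not at h0 h0'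
    exact exists_linked_mem_of_forall_pos hT (fun l hl => ⟨hP l hl, Nat.pos_of_ne_zero (h0 l hl)⟩)
      (fun l hl => ⟨hQ l hl, Nat.pos_of_ne_zero (h0' l hl)⟩) (htot 1 1)
      (exists_switchType_eq hbP hbQ hcard hpos (htot 0 1) (htot 1 0))

lemma card_mul_eq {T : ℕ} {P : Multiset (List (Fin 2))} (hP : ∀ l ∈ P, l.length = T) :
    P.card * (T - 1) = totalTransitions 0 0 P + totalTransitions 1 1 P +
      totalTransitions 0 1 P + totalTransitions 1 0 P := by
  induction P using Multiset.induction with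
  | empty => simp
  | cons a P ih =>
    have h := ih fun l hl => hP l (Multiset.mem_cons_of_mem hl)
    have ha := sum_numTransitions a
    rw [hP a (by simp)] at ha
    simp only [Multiset.card_cons, totalTransitions_cons, add_mul, one_mul]
    omega

/-- Multisets of paths of length `T` with the same total transition counts are connected by the
swappings. -/
theorem linked_of_totalTransitions_eq {T : ℕ} (hT : 3 ≤ T) {P Q : Multiset (List (Fin 2))}
    (hP : ∀ l ∈ P, l.length = T) (hQ : ∀ l ∈ Q, l.length = T)
    (htot : ∀ i j, totalTransitions i j P = totalTransitions i j Q) : Linked T P Q := by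
  have hcard : P.card = Q.card := by
    have h₁ := card_mul_eq hP
    have h₂ := card_mul_eq hQ
    simp only [htot, ← h₂] at h₁
    exact Nat.eq_of_mul_eq_mul_right (by omega) h₁
  induction hn : P.card generalizing P Q with
  | zero =>
    rw [hn] at hcard
    rw [Multiset.card_eq_zero.1 hn, Multiset.card_eq_zero.1 hcard.symm]
    exact Linked.refl _
  | succ n ih =>
    obtain ⟨P₁, hP₁, hbP⟩ := exists_linked_balanced (by omega) P hP
    obtain ⟨Q₁, hQ₁, hbQ⟩ := exists_linked_balanced (by omega) Q hQ
    obtain ⟨P₂, Q₂, l, hP₂, hQ₂, hlP, hlQ⟩ := exists_linked_mem_of_balanced hT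
      (hP₁.length_iff.1 hP) (hQ₁.length_iff.1 hQ) hbP hbQ
      (by rw [← hP₁.card_eq, ← hQ₁.card_eq, hcard]) (by rw [← hP₁.card_eq]; omega)
      (fun i j => by rw [← hP₁.totalTransitions_eq, ← hQ₁.totalTransitions_eq, htot])
    obtain ⟨M, rfl⟩ := Multiset.exists_cons_of_mem hlP
    obtain ⟨N, rfl⟩ := Multiset.exists_cons_of_mem hlQ
    have lP := hP₁.trans hP₂
    have lQ := hQ₁.trans hQ₂
    have hM := lP.length_iff.1 hP
    have hN := lQ.length_iff.1 hQ
    have hMc := lP.card_eq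
    have hNc := lQ.card_eq
    rw [Multiset.card_cons] at hMc hNc
    refine lP.trans (Linked.trans (Linked.cons (ih (fun l hl => hM l (Multiset.mem_cons_of_mem hl))
      (fun l hl => hN l (Multiset.mem_cons_of_mem hl)) (fun i j => ?_) (by omega) (by omega))
      (hM l (by simp))) lQ.symm)
    have h₁ := lP.totalTransitions_eq i j
    have h₂ := lQ.totalTransitions_eq i j
    have h₃ := htot i j
    rw [totalTransitions_cons] at h₁ h₂
    omega

/-! ### From multisets of paths to tables and moves. -/

lemma mem_twoStateMoves_iff {T : ℕ} {z : PathArray (Fin 2) T} :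
    z ∈ twoStateMoves T ↔ ∃ P Q : Multiset (StatePath (Fin 2) T),
      (BasicSwap T (P.map List.Vector.toList) (Q.map List.Vector.toList) ∨
        BasicSwap T (Q.map List.Vector.toList) (P.map List.Vector.toList)) ∧
      z = tableOf P - tableOf Q := by
  unfold twoStateMoves swapMoves BasicSwap
  simp only [Set.mem_union, Set.mem_ofPred_eq]
  constructor
  · rintro (((((⟨P, Q, h, rfl⟩ | ⟨P, Q, h, rfl⟩) | ⟨P, Q, h, rfl⟩) | ⟨hT, P, Q, h, rfl⟩) |
      ⟨P, Q, h, rfl⟩) | ⟨P, Q, h, rfl⟩) <;> exact ⟨P, Q, by tauto, rfl⟩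
  · rintro ⟨P, Q, (h | h | h | ⟨hT, h⟩ | h | h) | (h | h | h | ⟨hT, h⟩ | h | h), rfl⟩
    · exact Or.inl (Or.inl (Or.inl (Or.inl (Or.inl ⟨P, Q, Or.inl h, rfl⟩))))
    · exact Or.inl (Or.inl (Or.inl (Or.inl (Or.inr ⟨P, Q, Or.inl h, rfl⟩))))
    · exact Or.inl (Or.inl (Or.inl (Or.inr ⟨P, Q, Or.inl h, rfl⟩)))
    · exact Or.inl (Or.inl (Or.inr ⟨hT, P, Q, Or.inl h, rfl⟩))
    · exact Or.inl (Or.inr ⟨P, Q, Or.inl h, rfl⟩)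
    · exact Or.inr ⟨P, Q, Or.inl h, rfl⟩
    · exact Or.inl (Or.inl (Or.inl (Or.inl (Or.inl ⟨P, Q, Or.inr h, rfl⟩))))
    · exact Or.inl (Or.inl (Or.inl (Or.inl (Or.inr ⟨P, Q, Or.inr h, rfl⟩))))
    · exact Or.inl (Or.inl (Or.inl (Or.inr ⟨P, Q, Or.inr h, rfl⟩)))
    · exact Or.inl (Or.inl (Or.inr ⟨hT, P, Q, Or.inr h, rfl⟩))
    · exact Or.inl (Or.inr ⟨P, Q, Or.inr h, rfl⟩)
    · exact Or.inr ⟨P, Q, Or.inr h, rfl⟩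

lemma config_mulVec_tableOf {T : ℕ} (X : Multiset (StatePath (Fin 2) T)) :
    (config (Fin 2) T).mulVec (tableOf X) =
      fun ij => (totalTransitions ij.1 ij.2 (X.map List.Vector.toList) : ℤ) := by
  induction X using Multiset.induction with
  | empty =>
    have : tableOf (0 : Multiset (StatePath (Fin 2) T)) = 0 := by ext ω; simp [tableOf]
    rw [this, Matrix.mulVec_zero]
    ext ij
    simp
  | cons a X ih =>
    have : tableOf (a ::ₘ X) = Pi.single a 1 + tableOf X := by
      ext ω
      simp [tableOf, Multiset.count_cons, Pi.single_apply, add_comm]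
    rw [this, Matrix.mulVec_add, ih, Matrix.mulVec_single_one]
    ext ij
    simp [config]

lemma card_le_of_basicSwap {T : ℕ} {P Q : Multiset (StatePath (Fin 2) T)}
    (h : BasicSwap T (P.map List.Vector.toList) (Q.map List.Vector.toList) ∨
      BasicSwap T (Q.map List.Vector.toList) (P.map List.Vector.toList)) :
    P.card ≤ 3 ∧ Q.card ≤ 3 := by
  rcases h with h | h <;> have := h.card_eq <;> simp only [Multiset.card_map] at this <;> omega

lemma twoStateMoves_finite (T : ℕ) : (twoStateMoves T).Finite := by
  -- A swapping has at most three paths on each side, so the entries of a move lie between -3 and 3.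
  refine (Set.finite_Icc (-3 : PathArray (Fin 2) T) 3).subset fun z hz => ?_
  obtain ⟨P, Q, h, rfl⟩ := mem_twoStateMoves_iff.1 hz
  obtain ⟨hP, hQ⟩ := card_le_of_basicSwap h
  constructor <;> intro ω
  all_goals
    have h₁ := (Multiset.count_le_card ω P).trans hP
    have h₂ := (Multiset.count_le_card ω Q).trans hQ
    simp only [Pi.neg_apply, Pi.ofNat_apply, Pi.sub_apply, tableOf]
    omega

lemma mulVec_eq_zero_of_mem_twoStateMoves {T : ℕ} {z : PathArray (Fin 2) T}
    (hz : z ∈ twoStateMoves T) : (config (Fin 2) T).mulVec z = 0 := by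
  obtain ⟨P, Q, h, rfl⟩ := mem_twoStateMoves_iff.1 hz
  rw [Matrix.mulVec_sub, config_mulVec_tableOf, config_mulVec_tableOf]
  ext ij
  rcases h with h | h <;> simp [h.totalTransitions_eq ij.1 ij.2]

lemma moveDegree_le_of_mem_twoStateMoves {T : ℕ} {z : PathArray (Fin 2) T}
    (hz : z ∈ twoStateMoves T) : moveDegree z ≤ 3 := by
  obtain ⟨P, Q, h, rfl⟩ := mem_twoStateMoves_iff.1 hz
  have hP := (card_le_of_basicSwap h).1
  have hsum : ∑ ω, P.count ω = P.card := Multiset.sum_count_eq_card (by simp)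
  calc moveDegree (tableOf P - tableOf Q) ≤ ∑ ω, (P.count ω : ℤ) := by
        refine Finset.sum_le_sum fun ω _ => ?_
        simp only [Pi.sub_apply, tableOf]
        omega
    _ = P.card := by rw [← hsum]; push_cast; rfl
    _ ≤ 3 := by exact_mod_cast hP

/-- The table of a multiset of sequences, restricted to the paths of length `T`. -/
def listTable (T : ℕ) (P : Multiset (List (Fin 2))) : PathArray (Fin 2) T :=
  fun ω => (P.count ω.toList : ℤ)

lemma listTable_add (T : ℕ) (P Q : Multiset (List (Fin 2))) :
    listTable T (P + Q) = listTable T P + listTable T Q := by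
  ext ω
  simp [listTable]

lemma listTable_map_toList {T : ℕ} (X : Multiset (StatePath (Fin 2) T)) :
    listTable T (X.map List.Vector.toList) = tableOf X := by
  ext ω
  simp [listTable, tableOf, Multiset.count_map_eq_count' _ _ List.Vector.toList_injective]

lemma exists_map_toList_eq {T : ℕ} {P : Multiset (List (Fin 2))} (hP : ∀ l ∈ P, l.length = T) :
    ∃ X : Multiset (StatePath (Fin 2) T), X.map List.Vector.toList = P := by
  induction P using Multiset.induction with
  | empty => exact ⟨0, rfl⟩
  | cons a P ih =>
    obtain ⟨X, hX⟩ := ih fun l hl => hP l (Multiset.mem_cons_of_mem hl)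
    let ω : StatePath (Fin 2) T := ⟨a, hP a (by simp)⟩
    exact ⟨ω ::ₘ X, by rw [Multiset.map_cons, hX]; rfl⟩

/-- Two nonnegative tables that differ by a single move. -/
def TableStep (T : ℕ) (x y : PathArray (Fin 2) T) : Prop :=
  0 ≤ x ∧ 0 ≤ y ∧ y - x ∈ twoStateMoves T

lemma TableStep.symm {T : ℕ} {x y : PathArray (Fin 2) T} (h : TableStep T x y) :
    TableStep T y x := by
  obtain ⟨hx, hy, h⟩ := h
  obtain ⟨P, Q, hPQ, e⟩ := mem_twoStateMoves_iff.1 h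
  exact ⟨hy, hx, mem_twoStateMoves_iff.2 ⟨Q, P, hPQ.symm, by rw [← neg_sub y x, e, neg_sub]⟩⟩

/-- Tables of multisets are nonnegative by construction, and the paths not touched by a swapping
cancel in the difference of the tables. -/
lemma Linked.tableStep {T : ℕ} {P Q : Multiset (List (Fin 2))} (h : Linked T P Q) :
    Relation.ReflTransGen (TableStep T) (listTable T P) (listTable T Q) := by
  induction h with
  | rel _ _ h =>
    obtain ⟨P, Q, M, h, rfl, rfl, h₁, h₂⟩ := h
    obtain ⟨X, rfl⟩ := exists_map_toList_eq fun l hl => h₁ l (Multiset.mem_add.2 (Or.inl hl))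
    obtain ⟨Y, rfl⟩ := exists_map_toList_eq fun l hl => h₂ l (Multiset.mem_add.2 (Or.inl hl))
    refine Relation.ReflTransGen.single ⟨fun ω => ?_, fun ω => ?_, ?_⟩
    · simp [listTable]; positivity
    · simp [listTable]; positivity
    · rw [listTable_add, listTable_add, add_sub_add_right_eq_sub, listTable_map_toList,
        listTable_map_toList]
      exact mem_twoStateMoves_iff.2 ⟨Y, X, Or.inr h, rfl⟩
  | refl => exact Relation.ReflTransGen.refl
  | symm _ _ _ ih =>
    have : Std.Symm (TableStep T) := ⟨fun _ _ => TableStep.symm⟩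
    exact Std.Symm.symm _ _ ih
  | trans _ _ _ _ _ ih ih' => exact ih.trans ih'

lemma exists_moves_of_reflTransGen {T : ℕ} {x y : PathArray (Fin 2) T} (hy : 0 ≤ y)
    (h : Relation.ReflTransGen (TableStep T) x y) :
    ∃ (K : ℕ) (z : ℕ → PathArray (Fin 2) T), (∀ k < K, z k ∈ twoStateMoves T) ∧
      y = x + ∑ k ∈ Finset.range K, z k ∧
      ∀ l ≤ K, 0 ≤ x + ∑ k ∈ Finset.range l, z k := by
  induction h using Relation.ReflTransGen.head_induction_on with
  | refl =>
    refine ⟨0, fun _ => 0, by simp, by simp, fun l hl => ?_⟩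
    rw [Nat.le_zero.1 hl]
    simpa using hy
  | @head a b hab _ ih =>
    obtain ⟨K, z, hz, hsum, hpos⟩ := ih
    obtain ⟨ha, -, hm⟩ := hab
    -- The move `b - a` is put in front of the sequence `z`.
    set z' : ℕ → PathArray (Fin 2) T := fun k => Nat.casesOn k (b - a) z with hz'
    have key : ∀ l, a + ∑ k ∈ Finset.range (l + 1), z' k = b + ∑ k ∈ Finset.range l, z k := by
      intro l
      rw [Finset.sum_range_succ']
      change a + (∑ k ∈ Finset.range l, z k + (b - a)) = _
      abel
    refine ⟨K + 1, z', fun k hk => ?_, ?_, fun l hl => ?_⟩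
    · cases k with
      | zero => exact hm
      | succ k => exact hz k (by omega)
    · rw [key, hsum]
    · cases l with
      | zero => simpa using ha
      | succ l =>
        rw [key]
        exact hpos l (by omega)

lemma exists_tableOf_eq {T : ℕ} {x : PathArray (Fin 2) T} (hx : 0 ≤ x) :
    ∃ X : Multiset (StatePath (Fin 2) T), tableOf X = x := by
  refine ⟨∑ ω, (x ω).toNat • {ω}, ?_⟩
  ext ω
  simp only [tableOf, Multiset.count_sum', Multiset.count_nsmul, Multiset.count_singleton]
  simpa using hx ω

theorem theorem3p1 (T : ℕ) (hT : 3 ≤ T) :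
    IsMarkovBasis (twoStateMoves T) ∧ ∀ z ∈ twoStateMoves T, moveDegree z ≤ 3 := by
  refine ⟨⟨twoStateMoves_finite T, fun z hz => mulVec_eq_zero_of_mem_twoStateMoves hz,
    fun b x hx y hy => ?_⟩, fun z hz => moveDegree_le_of_mem_twoStateMoves hz⟩
  obtain ⟨hx0, hxb⟩ := hx
  obtain ⟨hy0, hyb⟩ := hy
  obtain ⟨X, rfl⟩ := exists_tableOf_eq hx0
  obtain ⟨Y, rfl⟩ := exists_tableOf_eq hy0
  have hlen : ∀ X : Multiset (StatePath (Fin 2) T), ∀ l ∈ X.map List.Vector.toList,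
      l.length = T := by
    intro X l hl
    obtain ⟨ω, -, rfl⟩ := Multiset.mem_map.1 hl
    exact ω.2
  have htot : ∀ i j, totalTransitions i j (X.map List.Vector.toList) =
      totalTransitions i j (Y.map List.Vector.toList) := by
    intro i j
    have h := congrFun (hxb.trans hyb.symm) (i, j)
    rw [config_mulVec_tableOf, config_mulVec_tableOf] at h
    simpa using h
  have h := (linked_of_totalTransitions_eq hT (hlen X) (hlen Y) htot).tableStep
  rw [listTable_map_toList, listTable_map_toList] at h
  exact exists_moves_of_reflTransGen hy0 h
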